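/- A \emph{$d$-polytope} $P\subset\mathbb{R}^n$ is the union of a finite complex of cells: each cell is the convex hull of a finite nonempty set of points (its vertices) and has dimension at most $d$, at least one cell has dimension $d$, every face of a cell is a cell, and any two cells meet in a (possibly empty) common face, spanned by their common vertices. The vertices of $P$ are the vertices of its cells, and $\partial P$ is the set of points that lie in the relative boundary of exactly one $d$-cell. A \emph{triangulation} $T$ of $P$ is a finite geometric simplicial complex with union $P$. A labelling (colouring) $\ell$ of the vertices of $P$ and of $T$ is a \emph{generalized Sperner labelling} if, whenever a vertex $v$ of $T$ lies in a cell $C$, $\ell(v)$ is the label of some vertex of $P$ in the affine span $\operatorname{aff}(C)$. \textbf{Theorem.} Let $P$ be a $d$-polytope, $T$ a triangulation of $P$, and $\ell$ a generalized Sperner labelling such that the vertices of $P$ on $\partial P$ have pairwise different colours. For every colour $c$ occurring on $T$ let $p_c$ be a vertex of $P$ of colour $c$ such that $p_{\ell(v)}\in\operatorname{aff}(C)$ whenever a vertex $v$ of $T$ lies in a cell $C$. (If the vertices of $P$ have pairwise different colours, for instance if $P$ is a convex polytope with its faces as cells and its vertices are coloured differently, then $p_c$ is just the vertex of colour $c$,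 and the condition is the generalized Sperner condition.) Let $H_t$, $t\in[0,1]$, be the homotopy that moves each vertex $v$ of $T$ along $(1-t)v+t\,p_{\ell(v)}$ and is extended to each simplex of $T$ by barycentric coordinates. Let $S$ be a set of simplices of $T$ with $$\partial P\not\subset\bigcup_{s\in S}\partial H_1(s),$$ where $\partial H_1(s)$ is the relative boundary of the convex set $H_1(s)$. Then $T$ has a full-coloured simplex $\tau$ (a $d$-simplex whose $d+1$ vertices have pairwise different colours) such that, for every $s\in S$, the set of colours of the vertices of $\tau$ differs from the set of colours of the vertices of $s$. -/

import Mathlib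

/-- The point set `F` spans a (possibly empty) face of the convex hull of the point set `C`, and
consists of all the points of `C` that lie on that face. -/
structure IsHullFace {n : ℕ} (F C : Set (EuclideanSpace ℝ (Fin n))) : Prop where
  subset : F ⊆ C
  isExtreme : IsExtreme ℝ (convexHull ℝ C) (convexHull ℝ F)
  mem_of_mem_hull : ∀ v ∈ C, v ∈ convexHull ℝ F → v ∈ F

/-- A `d`-polytope in `ℝⁿ`: a finite complex of cells. A cell is the convex hull of a finite
nonempty set of points and is recorded by that set. The cells have dimension at most `d`, at least
one has dimension `d`, faces of cells are cells, and two cells meet in a common face (which may be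
empty) spanned by their common vertices. -/
structure Polytope (n d : ℕ) where
  cells : Set (Finset (EuclideanSpace ℝ (Fin n)))
  finite_cells : cells.Finite
  nonempty_of_mem : ∀ C ∈ cells, C.Nonempty
  dim_le : ∀ C ∈ cells,
    Module.finrank ℝ (vectorSpan ℝ (C : Set (EuclideanSpace ℝ (Fin n)))) ≤ d
  exists_dim_eq : ∃ C ∈ cells,
    Module.finrank ℝ (vectorSpan ℝ (C : Set (EuclideanSpace ℝ (Fin n)))) = d
  face_mem : ∀ C ∈ cells, ∀ F : Finset (EuclideanSpace ℝ (Fin n)), F.Nonempty →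
    IsHullFace (F : Set (EuclideanSpace ℝ (Fin n))) C → F ∈ cells
  inter_eq : ∀ C ∈ cells, ∀ D ∈ cells,
    convexHull ℝ (C : Set (EuclideanSpace ℝ (Fin n))) ∩ convexHull ℝ D =
      convexHull ℝ ((C : Set (EuclideanSpace ℝ (Fin n))) ∩ D)
  inter_face : ∀ C ∈ cells, ∀ D ∈ cells,
    IsHullFace ((C : Set (EuclideanSpace ℝ (Fin n))) ∩ D) C

namespace Polytope

variable {n d : ℕ} (P : Polytope n d)

/-- The underlying point set: the union of all cells. -/
def space : Set (EuclideanSpace ℝ (Fin n)) :=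
  ⋃ C ∈ P.cells, convexHull ℝ (C : Set (EuclideanSpace ℝ (Fin n)))

/-- The vertices of the polytope: all vertices of its cells. -/
def vertices : Set (EuclideanSpace ℝ (Fin n)) :=
  {v | ∃ C ∈ P.cells, v ∈ C}

/-- The boundary `∂P`: the points that lie in the relative boundary of exactly one `d`-cell. -/
def boundary : Set (EuclideanSpace ℝ (Fin n)) :=
  {x | ∃! C : Finset (EuclideanSpace ℝ (Fin n)), C ∈ P.cells ∧
    Module.finrank ℝ (vectorSpan ℝ (C : Set (EuclideanSpace ℝ (Fin n)))) = d ∧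
    x ∈ intrinsicFrontier ℝ (convexHull ℝ (C : Set (EuclideanSpace ℝ (Fin n))))}

end Polytope

/-- `T` is a (finite) triangulation of the polytope `P`. -/
structure IsTriangulation {n d : ℕ} (P : Polytope n d)
    (T : Geometry.SimplicialComplex ℝ (EuclideanSpace ℝ (Fin n))) : Prop where
  finite : T.faces.Finite
  space_eq : T.space = P.space

/-- Generalized Sperner labelling: whenever a `T`-vertex `v` lies in a cell `C` of `P`, its label is
the label of some vertex of `P` in the affine span of `C`. -/
def IsGeneralizedSperner {n d : ℕ} {κ : Type*} (P : Polytope n d)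
    (T : Geometry.SimplicialComplex ℝ (EuclideanSpace ℝ (Fin n)))
    (label : EuclideanSpace ℝ (Fin n) → κ) : Prop :=
  ∀ v ∈ T.vertices, ∀ C ∈ P.cells,
    v ∈ convexHull ℝ (C : Set (EuclideanSpace ℝ (Fin n))) →
      ∃ w ∈ P.vertices, w ∈ affineSpan ℝ (C : Set (EuclideanSpace ℝ (Fin n))) ∧ label w = label v

/-- `dest` chooses, for each colour used on `T`, the vertex of `P` of that colour to which the
`T`-vertices of that colour travel; a `T`-vertex in a cell stays in the affine span of the cell.
If the vertices of `P` have pairwise distinct colours, such a `dest` exists exactly for the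
generalized Sperner labellings, and is unique on the colours used. -/
def IsDestination {n d : ℕ} {κ : Type*} (P : Polytope n d)
    (T : Geometry.SimplicialComplex ℝ (EuclideanSpace ℝ (Fin n)))
    (label : EuclideanSpace ℝ (Fin n) → κ) (dest : κ → EuclideanSpace ℝ (Fin n)) : Prop :=
  ∀ v ∈ T.vertices, dest (label v) ∈ P.vertices ∧ label (dest (label v)) = label v ∧
    ∀ C ∈ P.cells, v ∈ convexHull ℝ (C : Set (EuclideanSpace ℝ (Fin n))) →
      dest (label v) ∈ affineSpan ℝ (C : Set (EuclideanSpace ℝ (Fin n)))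

/-- `w` is the system of barycentric coordinates of `x` with respect to `T`: a convex combination
of the vertices of one simplex of `T` that represents `x`. -/
structure IsBarycentric {n : ℕ} (T : Geometry.SimplicialComplex ℝ (EuclideanSpace ℝ (Fin n)))
    (x : EuclideanSpace ℝ (Fin n)) (w : EuclideanSpace ℝ (Fin n) →₀ ℝ) : Prop where
  support_mem : w.support ∈ T.faces
  nonneg : ∀ v, 0 ≤ w v
  sum_eq_one : (w.sum fun _ a => a) = 1
  sum_smul_eq : (w.sum fun v a => a • v) = x

open Classical in
/-- The barycentric coordinates of `x` with respect to `T` (zero outside the space of `T`). -/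
noncomputable def barycentric {n : ℕ}
    (T : Geometry.SimplicialComplex ℝ (EuclideanSpace ℝ (Fin n)))
    (x : EuclideanSpace ℝ (Fin n)) : EuclideanSpace ℝ (Fin n) →₀ ℝ :=
  if h : ∃ w, IsBarycentric T x w then h.choose else 0

/-- The homotopy `H_t` induced by the labelling: each `T`-vertex `v` moves linearly, in time
`t ∈ [0, 1]`, to `dest (label v)`, and this is extended to every simplex of `T` by barycentric
coordinates. -/
noncomputable def labelHomotopy {n : ℕ} {κ : Type*}
    (T : Geometry.SimplicialComplex ℝ (EuclideanSpace ℝ (Fin n)))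
    (label : EuclideanSpace ℝ (Fin n) → κ) (dest : κ → EuclideanSpace ℝ (Fin n))
    (t : ℝ) (x : EuclideanSpace ℝ (Fin n)) : EuclideanSpace ℝ (Fin n) :=
  (barycentric T x).sum fun v a => a • ((1 - t) • v + t • dest (label v))

/-- A full-coloured simplex of `T`: a `d`-simplex whose `d + 1` vertices have distinct colours. -/
def IsFullColoured {n : ℕ} {κ : Type*} (d : ℕ)
    (T : Geometry.SimplicialComplex ℝ (EuclideanSpace ℝ (Fin n)))
    (label : EuclideanSpace ℝ (Fin n) → κ) (s : Finset (EuclideanSpace ℝ (Fin n))) : Prop :=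
  s ∈ T.faces ∧ s.card = d + 1 ∧ Set.InjOn label (s : Set (EuclideanSpace ℝ (Fin n)))

/-!
The argument is a degree count modulo 2. Let `A` be the affine span of a `d`-cell, and count, modulo
2, the images of the `d`-simplices of `T` in `A` that contain a generic point `y` of `A`. Moving a
single vertex inside `A` changes nothing: the simplex in its old position, the simplex in its new
position, and the facets through the vertex in its old position, each joined with the new position,
together cover `y` an even number of times. A facet is shared by an even number of simplices unless
each of its vertices lies in a cell contained in the hyperplane spanned by the facet; in that case
the join stays in this hyperplane, so that `y` is not in it. Hence the joins cancel, and after all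
vertices have moved the number is still 1 for `y` in `P` and 0 for `y` outside `P`. It therefore
changes across `∂P`, and every point of `∂P` lies on the relative boundary of the image of some
`d`-simplex whose vertices have different images.
-/

open Filter Topology AffineMap

section ConvexWeights

variable {ι E : Type*} [AddCommGroup E] [Module ℝ E] {I : Finset ι} {q : ι → E} {y y' : E}
  {w w' : ι → ℝ}

/-- The weights `w` represent `y` as a convex combination of the points `q i`, `i ∈ I`. The weights
outside `I` are arbitrary. -/
structure IsConvexRep (I : Finset ι) (q : ι → E) (y : E) (w : ι → ℝ) : Prop where
  nonneg : ∀ i ∈ I, 0 ≤ w i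
  sum_eq_one : ∑ i ∈ I, w i = 1
  sum_smul_eq : ∑ i ∈ I, w i • q i = y

theorem IsConvexRep.combo (hw : IsConvexRep I q y w) (hw' : IsConvexRep I q y' w') {a b : ℝ}
    (ha : 0 ≤ a) (hb : 0 ≤ b) (hab : a + b = 1) :
    IsConvexRep I q (a • y + b • y') (a • w + b • w') where
  nonneg i hi := add_nonneg (mul_nonneg ha (hw.nonneg i hi)) (mul_nonneg hb (hw'.nonneg i hi))
  sum_eq_one := by
    simp [Finset.sum_add_distrib, ← Finset.mul_sum, hw.sum_eq_one, hw'.sum_eq_one, hab]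
  sum_smul_eq := by
    simp [add_smul, mul_smul, Finset.sum_add_distrib, ← Finset.smul_sum, hw.sum_smul_eq,
      hw'.sum_smul_eq]

theorem isConvexRep_single [DecidableEq ι] {i : ι} (hi : i ∈ I) :
    IsConvexRep I q (q i) (Pi.single i 1) where
  nonneg j _ := by rcases eq_or_ne j i with rfl | h <;> simp [*]
  sum_eq_one := by simp [hi]
  sum_smul_eq := by simp [Pi.single_apply, ite_smul, hi]

theorem mem_convexHull_image_iff {t : Set ι} (ht : t ⊆ I) :
    y ∈ convexHull ℝ (q '' t) ↔ ∃ w, IsConvexRep I q y w ∧ ∀ i ∈ I, i ∉ t → w i = 0 := by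
  classical
  constructor
  · intro hy
    refine convexHull_min (t := {y | ∃ w, IsConvexRep I q y w ∧ ∀ i ∈ I, i ∉ t → w i = 0})
      ?_ ?_ hy
    · rintro _ ⟨i, hi, rfl⟩
      refine ⟨Pi.single i 1, isConvexRep_single (ht hi), fun j _ hj => ?_⟩
      exact Pi.single_eq_of_ne (by rintro rfl; exact hj hi) _
    · rintro _ ⟨w, hw, hw0⟩ _ ⟨w', hw', hw0'⟩ a b ha hb hab
      exact ⟨_, hw.combo hw' ha hb hab, fun i hi hit => by simp [hw0 i hi hit, hw0' i hi hit]⟩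
  · rintro ⟨w, hw, hw0⟩
    rw [← hw.sum_smul_eq, ← Finset.centerMass_eq_of_sum_1 _ _ hw.sum_eq_one,
      ← Finset.centerMass_filter_ne_zero]
    refine Finset.centerMass_mem_convexHull _ (fun i hi => hw.nonneg i (Finset.mem_filter.1 hi).1)
      (by rw [Finset.sum_filter_ne_zero, hw.sum_eq_one]; exact one_pos) fun i hi => ?_
    rw [Finset.mem_filter] at hi
    exact Set.mem_image_of_mem q (by_contra fun hit => hi.2 (hw0 i hi.1 hit))

theorem mem_convexHull_coe_iff {C : Finset E} :
    y ∈ convexHull ℝ (C : Set E) ↔ ∃ w, IsConvexRep C id y w := by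
  simpa +contextual using mem_convexHull_image_iff (q := id) (y := y) (Set.Subset.refl (C : Set E))

end ConvexWeights

theorem exists_add_mul_eq_zero_of_neg {ι : Type*} [Finite ι] {w k : ι → ℝ} (hw : ∀ i, 0 ≤ w i)
    (hk : ∃ i, k i < 0) :
    ∃ s, ∃ j, k j < 0 ∧ w j + s * k j = 0 ∧ ∀ i, 0 ≤ w i + s * k i := by
  classical
  have := Fintype.ofFinite ι
  -- `s` is the first time at which a decreasing coordinate of `w + s k` vanishes.
  obtain ⟨j, hj, hmin⟩ := ({i | k i < 0} : Finset ι).exists_min_image (fun i => w i / -k i)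
    (by obtain ⟨i, hi⟩ := hk; exact ⟨i, by simpa using hi⟩)
  simp only [Finset.mem_filter, Finset.mem_univ, true_and] at hj hmin
  refine ⟨w j / -k j, j, hj, by field_simp [hj.ne]; ring, fun i => ?_⟩
  rcases lt_or_ge (k i) 0 with hi | hi
  · have := hmin i hi
    rw [le_div_iff₀ (by linarith)] at this
    linarith
  · have := hw i
    have := div_nonneg (hw j) (neg_nonneg.2 hj.le)
    positivity

section AffineRelations

variable {ι E : Type*} [Fintype ι] [AddCommGroup E] [Module ℝ E] {q : ι → E} {y : E}
  {w w' k : ι → ℝ}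

/-- The affine relations between the points `q i`. They are the directions in which the weights of
a convex combination of these points can be moved without moving the point they represent. -/
def affineRelations (q : ι → E) : Submodule ℝ (ι → ℝ) where
  carrier := {k | ∑ i, k i = 0 ∧ ∑ i, k i • q i = 0}
  add_mem' := by
    rintro k l ⟨hk, hkq⟩ ⟨hl, hlq⟩
    simp [Finset.sum_add_distrib, add_smul, hk, hkq, hl, hlq]
  zero_mem' := by simp
  smul_mem' := by
    rintro c k ⟨hk, hkq⟩
    simp [← Finset.mul_sum, mul_smul, ← Finset.smul_sum, hk, hkq]

theorem affineRelations_eq_bot_iff : affineRelations q = ⊥ ↔ AffineIndependent ℝ q := by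
  rw [affineIndependent_iff_of_fintype, Submodule.eq_bot_iff]
  constructor
  · intro h k hk hkq
    rw [Finset.weightedVSub_eq_linear_combination _ hk] at hkq
    exact congrFun (h k ⟨hk, hkq⟩)
  · rintro h k ⟨hk, hkq⟩
    exact funext (h k hk (by rwa [Finset.weightedVSub_eq_linear_combination _ hk]))

theorem exists_neg_of_mem_affineRelations (hk : k ∈ affineRelations q) (hk0 : k ≠ 0) :
    ∃ i, k i < 0 := by
  by_contra! h
  exact hk0 (funext fun i =>
    (Finset.sum_eq_zero_iff_of_nonneg fun i _ => h i).1 hk.1 i (Finset.mem_univ i))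

theorem IsConvexRep.sub_mem_affineRelations (hw : IsConvexRep .univ q y w)
    (hw' : IsConvexRep .univ q y w') : w' - w ∈ affineRelations q := by
  constructor
  · simp [Finset.sum_sub_distrib, hw.sum_eq_one, hw'.sum_eq_one]
  · simp [Finset.sum_sub_distrib, sub_smul, hw.sum_smul_eq, hw'.sum_smul_eq]

theorem IsConvexRep.exists_eq_zero_of_neg (hw : IsConvexRep .univ q y w)
    (hk : k ∈ affineRelations q) (hneg : ∃ i, k i < 0) :
    ∃ s : ℝ, ∃ j, k j < 0 ∧ (w + s • k) j = 0 ∧ IsConvexRep .univ q y (w + s • k) := by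
  obtain ⟨s, j, hj, hj0, hnonneg⟩ :=
    exists_add_mul_eq_zero_of_neg (fun i => hw.nonneg i (Finset.mem_univ i)) hneg
  refine ⟨s, j, hj, hj0, fun i _ => hnonneg i, ?_, ?_⟩
  · simp [Finset.sum_add_distrib, ← Finset.mul_sum, hw.sum_eq_one, hk.1]
  · simp [Finset.sum_add_distrib, add_smul, mul_smul, ← Finset.smul_sum, hw.sum_smul_eq, hk.2]

theorem mem_convexHull_image_compl_singleton_iff {j : ι} :
    y ∈ convexHull ℝ (q '' {j}ᶜ) ↔ ∃ w, IsConvexRep .univ q y w ∧ w j = 0 := by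
  rw [mem_convexHull_image_iff (I := .univ) (by simp)]
  simp

variable (hgen : ∀ i j, i ≠ j → y ∉ convexHull ℝ (q '' {i, j}ᶜ))
include hgen

theorem IsConvexRep.eq_of_eq_zero {i j : ι} (hw : IsConvexRep .univ q y w) (hi : w i = 0)
    (hj : w j = 0) : i = j := by
  by_contra hij
  refine hgen i j hij ((mem_convexHull_image_iff (I := .univ) (by simp)).2 ⟨w, hw, ?_⟩)
  rintro l - hl
  rcases Set.notMem_compl_iff.1 hl with rfl | rfl
  exacts [hi, hj]

theorem eq_zero_of_mem_affineRelations {i : ι} (hw : IsConvexRep .univ q y w) (hi : w i = 0)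
    (hk : k ∈ affineRelations q) (hki : k i = 0) : k = 0 := by
  by_contra hk0
  obtain ⟨s, j, hj, hj0, hw'⟩ :=
    hw.exists_eq_zero_of_neg hk (exists_neg_of_mem_affineRelations hk hk0)
  obtain rfl : j = i := hw'.eq_of_eq_zero hgen hj0 (by simp [hi, hki])
  exact hj.ne hki

theorem eq_of_pos_of_mem_affineRelations {i j : ι} (hk : k ∈ affineRelations q)
    (hw : IsConvexRep .univ q y w) (hi : w i = 0) (hki : 0 < k i)
    (hw' : IsConvexRep .univ q y w') (hj : w' j = 0) (hkj : 0 < k j) : i = j := by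
  set δ := w' - w with hδ
  have hprop : k i • δ - δ i • k = 0 := eq_zero_of_mem_affineRelations hgen hw hi
    (sub_mem (Submodule.smul_mem _ _ (hw.sub_mem_affineRelations hw')) (Submodule.smul_mem _ _ hk))
    (by simp [mul_comm])
  have hprop_j : k i * -w j - w' i * k j = 0 := by simpa [hδ, hi, hj] using congrFun hprop j
  have hwj : 0 ≤ w j := hw.nonneg j (Finset.mem_univ j)
  have hw'i : 0 ≤ w' i * k j := mul_nonneg (hw'.nonneg i (Finset.mem_univ i)) hkj.le
  exact hw.eq_of_eq_zero hgen hi (by nlinarith)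

theorem even_card_mem_convexHull_image_compl_singleton (hq : ¬AffineIndependent ℝ q)
    [DecidablePred fun j => y ∈ convexHull ℝ (q '' {j}ᶜ)] :
    Even (Finset.card {j | y ∈ convexHull ℝ (q '' {j}ᶜ)}) := by
  classical
  rcases Finset.eq_empty_or_nonempty {j | y ∈ convexHull ℝ (q '' {j}ᶜ)} with h | ⟨i, hi⟩
  · simp [h]
  obtain ⟨w, hw, -⟩ := mem_convexHull_image_compl_singleton_iff.1 (Finset.mem_filter.1 hi).2
  rw [← affineRelations_eq_bot_iff] at hq
  obtain ⟨k, hk, hk0⟩ := (Submodule.ne_bot_iff _).1 hq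
  have hk' : -k ∈ affineRelations q := neg_mem hk
  -- The omitted vertices are one where `k` is negative and one where `k` is positive.
  obtain ⟨s, a, ha, ha0, hwa⟩ :=
    hw.exists_eq_zero_of_neg hk (exists_neg_of_mem_affineRelations hk hk0)
  obtain ⟨t, b, hb, hb0, hwb⟩ :=
    hw.exists_eq_zero_of_neg hk' (exists_neg_of_mem_affineRelations hk' (neg_ne_zero.2 hk0))
  have hab : a ≠ b := by rintro rfl; simp at hb; linarith
  suffices ({j | y ∈ convexHull ℝ (q '' {j}ᶜ)} : Finset ι) = {a, b} by
    rw [this, Finset.card_pair hab]; exact even_two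
  ext j
  simp only [Finset.mem_filter, Finset.mem_univ, true_and, Finset.mem_insert,
    Finset.mem_singleton, mem_convexHull_image_compl_singleton_iff]
  constructor
  · rintro ⟨u, hu, hj0⟩
    rcases lt_trichotomy (k j) 0 with hj | hj | hj
    · exact .inl (eq_of_pos_of_mem_affineRelations hgen hk' hu hj0 (neg_pos.2 hj) hwa ha0
        (neg_pos.2 ha))
    · exact absurd (eq_zero_of_mem_affineRelations hgen hu hj0 hk hj) hk0
    · exact .inr (eq_of_pos_of_mem_affineRelations hgen hk hu hj0 hj hwb hb0 (neg_neg_iff_pos.1 hb))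
  · rintro (rfl | rfl)
    exacts [⟨_, hwa, ha0⟩, ⟨_, hwb, hb0⟩]

end AffineRelations

theorem sum_lineMap_eq_one {ι : Type*} {s : Finset ι} {w c : ι → ℝ}
    (hw : ∑ v ∈ s, w v = 1) (hc : ∑ v ∈ s, c v = 1) (r : ℝ) :
    ∑ v ∈ s, lineMap (w v) (c v) r = 1 := by
  simp [lineMap_apply_module, Finset.sum_add_distrib, ← Finset.mul_sum, hw, hc]

section AffineWeights

variable {E : Type*} [AddCommGroup E] [Module ℝ E] {s : Finset E} {a z : E} {w c : E → ℝ}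

theorem mem_affineSpan_coe_iff :
    a ∈ affineSpan ℝ (s : Set E) ↔ ∃ c : E → ℝ, ∑ v ∈ s, c v = 1 ∧ ∑ v ∈ s, c v • v = a := by
  constructor
  · intro ha
    rw [← Set.image_id (s : Set E)] at ha
    obtain ⟨t, c, hts, hc, rfl⟩ := eq_affineCombination_of_mem_affineSpan_image ha
    have hc' : ∑ v ∈ s, (t : Set E).indicator c v = 1 := by rwa [Finset.sum_indicator_subset _ hts]
    exact ⟨_, hc', by rw [Finset.affineCombination_indicator_subset _ _ hts,
      Finset.affineCombination_eq_linear_combination _ _ _ hc']; rfl⟩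
  · rintro ⟨c, hc, rfl⟩
    have := affineCombination_mem_affineSpan_image hc (s' := s) (fun v hv hvs => absurd hv hvs) id
    rwa [Finset.affineCombination_eq_linear_combination _ _ _ hc, Set.image_id] at this

theorem lineMap_sum_smul (r : ℝ) :
    lineMap (∑ v ∈ s, w v • v) (∑ v ∈ s, c v • v) r = ∑ v ∈ s, lineMap (w v) (c v) r • v := by
  simp [lineMap_apply_module, add_smul, mul_smul, Finset.sum_add_distrib, Finset.smul_sum]

theorem weights_eq_of_affineIndependent (hs : AffineIndependent ℝ ((↑) : s → E))
    (hsum : ∑ v ∈ s, w v = ∑ v ∈ s, c v) (hsmul : ∑ v ∈ s, w v • v = ∑ v ∈ s, c v • v) :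
    ∀ v ∈ s, w v = c v := by
  intro v hv
  refine sub_eq_zero.1 (affineIndependent_iff.1 hs .univ (fun v => w v - c v) ?_ ?_ ⟨v, hv⟩
    (Finset.mem_univ _))
  · rw [Finset.sum_coe_sort s (fun v => w v - c v), Finset.sum_sub_distrib, hsum, sub_self]
  · rw [Finset.sum_coe_sort s (fun v => (w v - c v) • v)]
    simp only [sub_smul, Finset.sum_sub_distrib, hsmul, sub_self]

theorem sum_smul_mem_convexHull_iff (hs : AffineIndependent ℝ ((↑) : s → E))
    (hc : ∑ v ∈ s, c v = 1) :
    ∑ v ∈ s, c v • v ∈ convexHull ℝ (s : Set E) ↔ ∀ v ∈ s, 0 ≤ c v := by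
  rw [mem_convexHull_coe_iff]
  constructor
  · rintro ⟨w, hw⟩ v hv
    rw [← weights_eq_of_affineIndependent hs (hw.sum_eq_one.trans hc.symm) hw.sum_smul_eq v hv]
    exact hw.nonneg v hv
  · exact fun hc0 => ⟨c, hc0, hc, rfl⟩

theorem eventually_lineMap_pos {x : ℝ} (hx : 0 < x) (b : ℝ) :
    ∀ᶠ r in 𝓝 (0 : ℝ), 0 < lineMap x b r :=
  AffineMap.lineMap_continuous.continuousAt.eventually (lt_mem_nhds (by simpa))

theorem IsConvexRep.eventually_lineMap_mem (hw : IsConvexRep s id z w) (hpos : ∀ v ∈ s, 0 < w v)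
    (ha : a ∈ affineSpan ℝ (s : Set E)) :
    ∀ᶠ r in 𝓝 (0 : ℝ), lineMap z a r ∈ convexHull ℝ (s : Set E) := by
  obtain ⟨c, hc, rfl⟩ := mem_affineSpan_coe_iff.1 ha
  filter_upwards [(eventually_all_finset s).2 fun v hv => eventually_lineMap_pos (hpos v hv) (c v)]
    with r hr
  rw [← hw.sum_smul_eq]
  exact mem_convexHull_coe_iff.2 ⟨_, fun v hv => (hr v hv).le,
    sum_lineMap_eq_one hw.sum_eq_one hc r, (lineMap_sum_smul r).symm⟩

theorem mem_openSegment_lineMap_neg (z a : E) {r : ℝ} (hr : r < 0) :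
    z ∈ openSegment ℝ a (lineMap z a r) := by
  have : 0 < 1 - r := by linarith
  refine ⟨-r / (1 - r), 1 / (1 - r), div_pos (by linarith) this, div_pos one_pos this,
    by field_simp; ring, ?_⟩
  rw [lineMap_apply_module]
  match_scalars <;> field_simp
  ring

end AffineWeights

section MinimalFace

variable {E : Type*} [AddCommGroup E] [Module ℝ E] {C : Finset E} {z p : E} {v : E}

open Classical in
/-- The vertex set of the smallest face of `convexHull ℝ C` that contains `z`: the points of `C`
that occur with positive weight in some convex combination of `C` equal to `z`. -/
noncomputable def minimalFace (C : Finset E) (z : E) : Finset E :=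
  {v ∈ C | ∃ w, IsConvexRep C id z w ∧ 0 < w v}

theorem mem_minimalFace :
    v ∈ minimalFace C z ↔ v ∈ C ∧ ∃ w, IsConvexRep C id z w ∧ 0 < w v := by
  simp [minimalFace]

theorem minimalFace_subset : minimalFace C z ⊆ C :=
  fun _ hv => (mem_minimalFace.1 hv).1

theorem minimalFace_nonempty (hz : z ∈ convexHull ℝ (C : Set E)) : (minimalFace C z).Nonempty := by
  obtain ⟨w, hw⟩ := mem_convexHull_coe_iff.1 hz
  obtain ⟨v, hv, hwv⟩ := Finset.exists_ne_zero_of_sum_ne_zero (hw.sum_eq_one.trans_ne one_ne_zero)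
  exact ⟨v, mem_minimalFace.2 ⟨hv, w, hw, lt_of_le_of_ne (hw.nonneg v hv) hwv.symm⟩⟩

theorem IsConvexRep.restrict_minimalFace {w : E → ℝ} (hw : IsConvexRep C id z w) :
    IsConvexRep (minimalFace C z) id z w := by
  have hw0 : ∀ v ∈ C, v ∉ minimalFace C z → w v = 0 := fun v hv hvF =>
    le_antisymm (not_lt.1 fun h => hvF (mem_minimalFace.2 ⟨hv, w, hw, h⟩)) (hw.nonneg v hv)
  refine ⟨fun v hv => hw.nonneg v (minimalFace_subset hv), ?_, ?_⟩
  · rw [Finset.sum_subset minimalFace_subset hw0, hw.sum_eq_one]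
  · rw [Finset.sum_subset minimalFace_subset fun v hv hvF => by simp [hw0 v hv hvF],
      hw.sum_smul_eq]

theorem exists_isConvexRep_minimalFace_pos (hz : z ∈ convexHull ℝ (C : Set E)) :
    ∃ w, IsConvexRep (minimalFace C z) id z w ∧ ∀ v ∈ minimalFace C z, 0 < w v := by
  set F := minimalFace C z with hF
  choose! w hw hwpos using fun v (hv : v ∈ F) => (mem_minimalFace.1 hv).2
  have hcard : (0 : ℝ) < F.card := by exact_mod_cast (minimalFace_nonempty hz).card_pos
  -- The average of representations that are positive at the single vertices.
  refine ⟨∑ v ∈ F, (F.card : ℝ)⁻¹ • w v, ?_, fun u hu => ?_⟩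
  · have hconv : Convex ℝ {w | IsConvexRep F id z w} := fun w hw w' hw' a b ha hb hab => by
      simpa [← add_smul, hab] using IsConvexRep.combo hw hw' ha hb hab
    exact hconv.sum_mem (fun _ _ => by positivity) (by simp [hcard.ne'])
      fun v hv => (hw v hv).restrict_minimalFace
  · rw [Finset.sum_apply]
    exact Finset.sum_pos' (fun v hv => mul_nonneg (by positivity)
      ((hw v hv).nonneg u (minimalFace_subset hu))) ⟨u, hu, mul_pos (by positivity) (hwpos u hu)⟩

theorem IsConvexRep.mem_minimalFace_of_mem_openSegment {x y : E} {w : E → ℝ}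
    (hw : IsConvexRep C id x w) (hy : y ∈ convexHull ℝ (C : Set E)) (hp : p ∈ openSegment ℝ x y)
    (hv : v ∈ C) (hwv : 0 < w v) : v ∈ minimalFace C p := by
  obtain ⟨w', hw'⟩ := mem_convexHull_coe_iff.1 hy
  obtain ⟨a, b, ha, hb, hab, rfl⟩ := hp
  exact mem_minimalFace.2 ⟨hv, _, hw.combo hw' ha.le hb.le hab,
    add_pos_of_pos_of_nonneg (mul_pos ha hwv) (mul_nonneg hb.le (hw'.nonneg v hv))⟩

theorem minimalFace_subset_minimalFace (hz : z ∈ convexHull ℝ (C : Set E))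
    (hp : p ∈ convexHull ℝ (minimalFace C z : Set E)) : minimalFace C p ⊆ minimalFace C z := by
  intro v hv
  obtain ⟨hvC, w, hw, hwv⟩ := mem_minimalFace.1 hv
  obtain ⟨u, hu, hupos⟩ := exists_isConvexRep_minimalFace_pos hz
  have hmem := hu.eventually_lineMap_mem hupos (convexHull_subset_affineSpan _ hp)
  obtain ⟨r, hr0, hr⟩ := hmem.exists_lt
  exact hw.mem_minimalFace_of_mem_openSegment (convexHull_mono minimalFace_subset hr)
    (mem_openSegment_lineMap_neg z p hr0) hvC hwv

theorem isExtreme_convexHull_minimalFace (hz : z ∈ convexHull ℝ (C : Set E)) :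
    IsExtreme ℝ (convexHull ℝ (C : Set E)) (convexHull ℝ (minimalFace C z : Set E)) where
  subset := convexHull_mono minimalFace_subset
  left_mem_of_mem_openSegment x hx y hy p hp hpxy := by
    obtain ⟨w, hw⟩ := mem_convexHull_coe_iff.1 hx
    rw [← Set.image_id (minimalFace C z : Set E)]
    refine (mem_convexHull_image_iff (Finset.coe_subset.2 minimalFace_subset)).2
      ⟨w, hw, fun v hv hvF => by_contra fun hwv => hvF ?_⟩
    exact minimalFace_subset_minimalFace hz hp (hw.mem_minimalFace_of_mem_openSegment hy hpxy hv
      (lt_of_le_of_ne (hw.nonneg v hv) (Ne.symm hwv)))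

theorem mem_minimalFace_self (hv : v ∈ C) : v ∈ minimalFace C v := by
  classical
  exact mem_minimalFace.2 ⟨hv, Pi.single v 1, isConvexRep_single (q := id) hv, by simp⟩

theorem isHullFace_minimalFace {n : ℕ} {C : Finset (EuclideanSpace ℝ (Fin n))}
    {z : EuclideanSpace ℝ (Fin n)}
    (hz : z ∈ convexHull ℝ (C : Set (EuclideanSpace ℝ (Fin n)))) :
    IsHullFace (minimalFace C z : Set (EuclideanSpace ℝ (Fin n))) C where
  subset := minimalFace_subset
  isExtreme := isExtreme_convexHull_minimalFace hz
  mem_of_mem_hull _ hv hvF := minimalFace_subset_minimalFace hz hvF (mem_minimalFace_self hv)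

end MinimalFace

section IntrinsicTopology

variable {E : Type*} [NormedAddCommGroup E] [NormedSpace ℝ E] {K F : Set E} {x : E}

theorem tendsto_lineMap_nhds_zero (x a : E) :
    Tendsto (fun r : ℝ => lineMap x a r) (𝓝 0) (𝓝 x) := by
  simpa using (AffineMap.lineMap_continuous (p := x) (q := a)).tendsto (0 : ℝ)

theorem tendsto_lineMap_nhdsWithin {A : AffineSubspace ℝ E} {a : E} (hx : x ∈ A) (ha : a ∈ A) :
    Tendsto (fun r : ℝ => lineMap x a r) (𝓝 0) (𝓝[A] x) :=
  tendsto_nhdsWithin_iff.2 ⟨tendsto_lineMap_nhds_zero x a,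
    .of_forall fun r => AffineMap.lineMap_mem r hx ha⟩

theorem mem_intrinsicFrontier_iff_of_mem (hx : x ∈ K) :
    x ∈ intrinsicFrontier ℝ K ↔ K ∉ 𝓝[affineSpan ℝ K] x := by
  have hxA : x ∈ affineSpan ℝ K := subset_affineSpan ℝ K hx
  have hfrontier : x ∈ intrinsicFrontier ℝ K ↔
      (⟨x, hxA⟩ : affineSpan ℝ K) ∈ frontier ((↑) ⁻¹' K) := by
    simp [mem_intrinsicFrontier, hxA]
  rw [hfrontier, mem_frontier_iff_notMem_interior (by exact hx), mem_interior_iff_mem_nhds]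
  exact not_congr preimage_coe_mem_nhds_subtype

theorem subset_of_isExtreme_of_mem_nhdsWithin (hF : IsExtreme ℝ K F) (hx : x ∈ F)
    (hK : K ∈ 𝓝[affineSpan ℝ K] x) : K ⊆ F := by
  intro y hy
  have hmem := (tendsto_lineMap_nhdsWithin (subset_affineSpan ℝ K (hF.subset hx))
    (subset_affineSpan ℝ K hy)).eventually hK
  obtain ⟨r, hr0, hr⟩ := hmem.exists_lt
  exact hF.left_mem_of_mem_openSegment hy hr hx (mem_openSegment_lineMap_neg x y hr0)

end IntrinsicTopology

section GenericPoints

variable {E : Type*} [AddCommGroup E] [Module ℝ E] {A B : AffineSubspace ℝ E} {X K : Set E}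
  {x y z : E}

/-- The point `y` of the affine subspace `A` is in general position with respect to the points of
`X`: it lies in the affine span of a subset of `X` only if all of `A` does. -/
def IsGenericIn (X : Set E) (A : AffineSubspace ℝ E) (y : E) : Prop :=
  y ∈ A ∧ ∀ Y ⊆ X, y ∈ affineSpan ℝ Y → A ≤ affineSpan ℝ Y

theorem IsGenericIn.mono {X' : Set E} (hy : IsGenericIn X' A y) (hX : X ⊆ X') :
    IsGenericIn X A y :=
  ⟨hy.1, fun Y hY => hy.2 Y (hY.trans hX)⟩

theorem subsingleton_setOf_lineMap_mem (h : ¬(x ∈ B ∧ y ∈ B)) :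
    {r : ℝ | lineMap x y r ∈ B}.Subsingleton := by
  intro r hr r' hr'
  by_contra hne
  have hline (t : ℝ) : lineMap x y t ∈ B := by
    have ht : lineMap r r' ((t - r) / (r' - r)) = t := by
      have := sub_ne_zero.2 (Ne.symm hne)
      rw [lineMap_apply_ring']
      field_simp
      ring
    rw [← ht, AffineMap.apply_lineMap]
    exact AffineMap.lineMap_mem _ hr hr'
  exact h ⟨by simpa using hline 0, by simpa using hline 1⟩

theorem eventually_lineMap_notMem (h : ¬(x ∈ B ∧ y ∈ B)) :
    ∀ᶠ r in 𝓝[≠] (0 : ℝ), lineMap x y r ∉ B :=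
  (subsingleton_setOf_lineMap_mem h).finite.eventually_cofinite_notMem.filter_mono
    (nhdsNE_le_cofinite 0)

theorem IsGenericIn.eventually_lineMap (hX : X.Finite) (hy : IsGenericIn X A y) (hx : x ∈ A) :
    ∀ᶠ r in 𝓝[≠] (0 : ℝ), IsGenericIn X A (lineMap x y r) := by
  have havoid : ∀ᶠ r in 𝓝[≠] (0 : ℝ), ∀ Y ∈ {Y | Y ⊆ X},
      lineMap x y r ∈ affineSpan ℝ Y → A ≤ affineSpan ℝ Y := by
    refine (eventually_all_finite hX.finite_subsets).2 fun Y hY => ?_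
    by_cases hyY : y ∈ affineSpan ℝ Y
    · exact .of_forall fun _ _ => hy.2 Y hY hyY
    · filter_upwards [eventually_lineMap_notMem fun h => hyY h.2] with r hr h
      exact absurd h hr
  filter_upwards [havoid] with r hr
  exact ⟨AffineMap.lineMap_mem r hx hy.1, hr⟩

theorem exists_mem_forall_mem_imp_subset (hK : Convex ℝ K) (hne : K.Nonempty)
    {𝓑 : Set (AffineSubspace ℝ E)} (h𝓑 : 𝓑.Finite) :
    ∃ z ∈ K, ∀ B ∈ 𝓑, z ∈ B → K ⊆ B := by
  induction 𝓑, h𝓑 using Set.Finite.induction_on with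
  | empty => exact ⟨_, hne.some_mem, by simp⟩
  | @insert B 𝓑 _ h𝓑 ih =>
    obtain ⟨z, hz, hz𝓑⟩ := ih
    by_cases hKB : K ⊆ B
    · exact ⟨z, hz, Set.forall_mem_insert.2 ⟨fun _ => hKB, hz𝓑⟩⟩
    obtain ⟨w, hw, hwB⟩ := Set.not_subset.1 hKB
    have havoid : ∀ᶠ r in 𝓝[≠] (0 : ℝ), ∀ B' ∈ 𝓑, z ∉ B' → lineMap z w r ∉ B' :=
      (eventually_all_finite h𝓑).2 fun B' _ => eventually_imp_distrib_left.2 fun hzB' =>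
        eventually_lineMap_notMem fun h => hzB' h.1
    have hsmall : ∀ᶠ r in 𝓝[>] (0 : ℝ), r ∈ Set.Ioo (0 : ℝ) 1 := Ioo_mem_nhdsGT one_pos
    obtain ⟨r, hr, hrB, hr𝓑⟩ := (hsmall.and (((eventually_lineMap_notMem fun h => hwB h.2).and
      havoid).filter_mono (nhdsGT_le_nhdsNE 0))).exists
    refine ⟨lineMap z w r, hK.lineMap_mem hz hw ⟨hr.1.le, hr.2.le⟩,
      Set.forall_mem_insert.2 ⟨fun h => absurd h hrB, fun B' hB' h => hz𝓑 B' hB' ?_⟩⟩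
    exact by_contra fun hzB' => hr𝓑 B' hB' hzB' h

theorem exists_isGenericIn_affineSpan (hX : X.Finite) (hK : Convex ℝ K) (hne : K.Nonempty) :
    ∃ y ∈ K, IsGenericIn X (affineSpan ℝ K) y := by
  obtain ⟨y, hy, hyX⟩ :=
    exists_mem_forall_mem_imp_subset hK hne (hX.finite_subsets.image (affineSpan ℝ))
  exact ⟨y, hy, subset_affineSpan ℝ K hy, fun Y hY hyY =>
    affineSpan_le.2 (hyX _ (Set.mem_image_of_mem _ hY) hyY)⟩

theorem finrank_direction_lt_card_of_le_affineSpan {G : Finset E} (hG : G.Nonempty)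
    (hA : A ≤ affineSpan ℝ (G : Set E)) : Module.finrank ℝ A.direction < G.card := by
  have := hG.coe_sort
  have hle : Module.finrank ℝ A.direction ≤ Module.finrank ℝ (vectorSpan ℝ (G : Set E)) := by
    have := finiteDimensional_vectorSpan_of_finite ℝ G.finite_toSet
    exact Submodule.finrank_mono
      ((AffineSubspace.direction_le hA).trans (direction_affineSpan ℝ _).le)
  have hcard := finrank_vectorSpan_range_add_one_le ℝ ((↑) : G → E)
  rw [Fintype.card_coe, show Set.range ((↑) : G → E) = G from Subtype.range_coe] at hcard
  exact hle.trans_lt (Nat.lt_of_succ_le hcard)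

theorem injOn_of_le_affineSpan_image {ι : Type*} {f : ι → E} {σ : Finset ι} (hσ : σ.Nonempty)
    (hcard : σ.card ≤ Module.finrank ℝ A.direction + 1) (hA : A ≤ affineSpan ℝ (f '' σ)) :
    Set.InjOn f σ := by
  classical
  rw [← Finset.coe_image] at hA
  exact Finset.injOn_of_card_image_eq <| Finset.card_image_le.antisymm <|
    hcard.trans (finrank_direction_lt_card_of_le_affineSpan (hσ.image f) hA)

theorem IsGenericIn.finrank_direction_lt_card {G : Finset E} (hy : IsGenericIn X A y)
    (hG : (G : Set E) ⊆ X) (hyG : y ∈ affineSpan ℝ (G : Set E)) :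
    Module.finrank ℝ A.direction < G.card :=
  finrank_direction_lt_card_of_le_affineSpan
    (Finset.coe_nonempty.1 ((affineSpan_nonempty ℝ).1 ⟨y, hyG⟩)) (hy.2 _ hG hyG)

theorem IsGenericIn.subset_of_mem_convexHull {s : Finset E} {t : Set E}
    (hs : AffineIndependent ℝ ((↑) : s → E)) (hz : IsGenericIn X (affineSpan ℝ (s : Set E)) z)
    (hsX : (s : Set E) ⊆ X) (hts : t ⊆ s) (hzt : z ∈ convexHull ℝ t) : (s : Set E) ⊆ t := by
  intro v hv
  have hspan := hz.2 t (hts.trans hsX) (convexHull_subset_affineSpan t hzt)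
  have hvt := hspan (subset_affineSpan ℝ _ hv)
  have himage : ((↑) : s → E) '' ((↑) ⁻¹' t) = t :=
    Set.image_preimage_eq_of_subset (by simpa using hts)
  exact (hs.mem_affineSpan_iff ⟨v, hv⟩ ((↑) ⁻¹' t)).1 (by rwa [himage])

theorem IsGenericIn.exists_isConvexRep_pos {s : Finset E} (hs : AffineIndependent ℝ ((↑) : s → E))
    (hz : IsGenericIn X (affineSpan ℝ (s : Set E)) z) (hsX : (s : Set E) ⊆ X)
    (hzs : z ∈ convexHull ℝ (s : Set E)) :
    ∃ w, IsConvexRep s id z w ∧ ∀ v ∈ s, 0 < w v := by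
  obtain ⟨w, hw, hpos⟩ := exists_isConvexRep_minimalFace_pos hzs
  have hsF : s ⊆ minimalFace s z := Finset.coe_subset.1 <| hz.subset_of_mem_convexHull hs hsX
    minimalFace_subset (mem_convexHull_coe_iff.2 ⟨w, hw⟩)
  rw [minimalFace_subset.antisymm hsF] at hw hpos
  exact ⟨w, hw, hpos⟩

end GenericPoints

section GenericDensity

variable {E : Type*} [NormedAddCommGroup E] [NormedSpace ℝ E] {X K : Set E} {x : E}

theorem frequently_isGenericIn_affineSpan (hX : X.Finite) (hK : Convex ℝ K) (hx : x ∈ K) :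
    ∃ᶠ y in 𝓝[K] x, IsGenericIn X (affineSpan ℝ K) y := by
  obtain ⟨a, haK, ha⟩ := exists_isGenericIn_affineSpan hX hK ⟨x, hx⟩
  have hsmall : ∀ᶠ r in 𝓝[>] (0 : ℝ), r ∈ Set.Ioo (0 : ℝ) 1 := Ioo_mem_nhdsGT one_pos
  have htendsto : Tendsto (fun r : ℝ => lineMap x a r) (𝓝[>] 0) (𝓝[K] x) :=
    tendsto_nhdsWithin_iff.2 ⟨(tendsto_lineMap_nhds_zero x a).mono_left nhdsWithin_le_nhds,
      hsmall.mono fun r hr => hK.lineMap_mem hx haK ⟨hr.1.le, hr.2.le⟩⟩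
  exact htendsto.frequently ((ha.eventually_lineMap hX
    (subset_affineSpan ℝ K hx)).filter_mono (nhdsGT_le_nhdsNE 0)).frequently

theorem frequently_isGenericIn_affineSpan_and_notMem (hX : X.Finite) (hK : IsClosed K)
    (hx : x ∈ intrinsicFrontier ℝ K) :
    ∃ᶠ y in 𝓝[affineSpan ℝ K] x, IsGenericIn X (affineSpan ℝ K) y ∧ y ∉ K := by
  set A := affineSpan ℝ K
  have hout : ∃ᶠ y in 𝓝[A] x, y ∈ A ∧ y ∉ K :=
    ((mem_intrinsicFrontier_iff_of_mem (intrinsicFrontier_subset hK hx)).1 hx).imp fun h =>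
      (h.and self_mem_nhdsWithin).mono fun y hy => by_contra fun hyK => hy.1 ⟨hy.2, hyK⟩
  intro hnot
  refine hout ((eventually_eventually_nhdsWithin.2 hnot).mono fun y hy ⟨hyA, hyK⟩ => ?_)
  have hgen := frequently_isGenericIn_affineSpan hX A.convex hyA
  rw [AffineSubspace.affineSpan_coe] at hgen
  have hnear : ∀ᶠ y' in 𝓝[A] y, y' ∉ K := nhdsWithin_le_nhds (hK.isOpen_compl.mem_nhds hyK)
  exact hgen ((hnear.and hy).mono fun y' h hy' => h.2 ⟨hy', h.1⟩)

end GenericDensity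

section FiniteDimensional

variable {E : Type*} [AddCommGroup E] [Module ℝ E] {A B : AffineSubspace ℝ E}
  [FiniteDimensional ℝ B.direction]

theorem eq_of_le_of_finrank_direction_le (hA : (A : Set E).Nonempty) (hle : A ≤ B)
    (hrank : Module.finrank ℝ B.direction ≤ Module.finrank ℝ A.direction) : A = B :=
  AffineSubspace.eq_of_direction_eq_of_nonempty_of_le
    (Submodule.eq_of_le_of_finrank_le (AffineSubspace.direction_le hle) hrank) hA hle

theorem finrank_direction_lt_of_lt (hA : (A : Set E).Nonempty) (hlt : A < B) :
    Module.finrank ℝ A.direction < Module.finrank ℝ B.direction :=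
  Submodule.finrank_lt_finrank_of_lt (AffineSubspace.direction_lt_of_nonempty hlt hA)

end FiniteDimensional

section Facets

variable {E : Type*} [AddCommGroup E] [Module ℝ E] {A : AffineSubspace ℝ E} {X : Set E} {y : E}

/-- The characteristic function, modulo 2, of the convex hull of `s`. Sums of these functions over
the simplices of a complex count, modulo 2, the simplices that contain a point. -/
noncomputable def hullIndicator (s : Set E) (y : E) : ZMod 2 :=
  (convexHull ℝ s).indicator 1 y

theorem hullIndicator_of_mem {s : Set E} (h : y ∈ convexHull ℝ s) : hullIndicator s y = 1 :=
  Set.indicator_of_mem h _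

theorem hullIndicator_of_notMem {s : Set E} (h : y ∉ convexHull ℝ s) : hullIndicator s y = 0 :=
  Set.indicator_of_notMem h _

theorem finrank_direction_affineSpan_add_one {s : Finset E}
    (hs : AffineIndependent ℝ ((↑) : s → E)) (hne : s.Nonempty) :
    Module.finrank ℝ (affineSpan ℝ (s : Set E)).direction + 1 = s.card := by
  have := hne.to_subtype
  have h := hs.finrank_vectorSpan_add_one
  rwa [Fintype.card_coe, show Set.range ((↑) : s → E) = s from Subtype.range_coe,
    ← direction_affineSpan] at h

variable {T : Geometry.SimplicialComplex ℝ E} (hT : T.faces.Finite) {σ τ ρ : Finset E}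

open Classical in
/-- The faces of a finite simplicial complex whose affine span is `A`. -/
noncomputable def spanningFaces (hT : T.faces.Finite) (A : AffineSubspace ℝ E) :
    Finset (Finset E) :=
  {σ ∈ hT.toFinset | affineSpan ℝ (σ : Set E) = A}

theorem mem_spanningFaces :
    σ ∈ spanningFaces hT A ↔ σ ∈ T.faces ∧ affineSpan ℝ (σ : Set E) = A := by
  simp [spanningFaces]

variable {hT} in
theorem card_of_mem_spanningFaces (hσ : σ ∈ spanningFaces hT A) :
    σ.card = Module.finrank ℝ A.direction + 1 := by
  obtain ⟨hσT, rfl⟩ := (mem_spanningFaces hT).1 hσ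
  exact (finrank_direction_affineSpan_add_one (T.indep hσT) (T.nonempty_of_mem_faces hσT)).symm

theorem IsGenericIn.affineSpan_eq (hy : IsGenericIn X A y) (hσX : (σ : Set E) ⊆ X)
    (hσ : AffineIndependent ℝ ((↑) : σ → E)) (hcard : σ.card ≤ Module.finrank ℝ A.direction + 1)
    (hyσ : y ∈ affineSpan ℝ (σ : Set E)) : affineSpan ℝ (σ : Set E) = A := by
  have hle : A ≤ affineSpan ℝ (σ : Set E) := hy.2 _ hσX hyσ
  have hfinrank : Module.finrank ℝ (affineSpan ℝ (σ : Set E)).direction ≤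
      Module.finrank ℝ A.direction := by
    have := finrank_direction_affineSpan_add_one hσ
      (Finset.coe_nonempty.1 ((affineSpan_nonempty ℝ).1 ⟨y, hyσ⟩))
    omega
  have : FiniteDimensional ℝ (affineSpan ℝ (σ : Set E)).direction :=
    finiteDimensional_direction_affineSpan_of_finite ℝ σ.finite_toSet
  exact (eq_of_le_of_finrank_direction_le ⟨y, hy.1⟩ hle hfinrank).symm

theorem face_subset_vertices (hσ : σ ∈ T.faces) : (σ : Set E) ⊆ T.vertices := by
  rw [Geometry.SimplicialComplex.vertices_eq]
  exact Set.subset_biUnion_of_mem (u := fun s : Finset E => (s : Set E)) hσ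

theorem vertices_finite (hT : T.faces.Finite) : T.vertices.Finite := by
  rw [Geometry.SimplicialComplex.vertices_eq]
  exact hT.biUnion fun s _ => s.finite_toSet

theorem IsGenericIn.face_subset_of_mem (hX : T.vertices ⊆ X) (hσ : σ ∈ T.faces)
    (hy : IsGenericIn X (affineSpan ℝ (σ : Set E)) y) (hyσ : y ∈ convexHull ℝ (σ : Set E))
    (hτ : τ ∈ T.faces) (hyτ : y ∈ convexHull ℝ (τ : Set E)) : σ ⊆ τ :=
  Finset.coe_subset.1 <| (hy.subset_of_mem_convexHull (T.indep hσ)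
    ((face_subset_vertices hσ).trans hX) Set.inter_subset_left
    (T.inter_subset_convexHull hσ hτ ⟨hyσ, hyτ⟩)).trans Set.inter_subset_right

theorem sum_hullIndicator_spanningFaces (hX : T.vertices ⊆ X) (hy : IsGenericIn X A y)
    (hcard : ∀ σ ∈ T.faces, σ.card ≤ Module.finrank ℝ A.direction + 1) :
    ∑ σ ∈ spanningFaces hT A, hullIndicator (σ : Set E) y = T.space.indicator 1 y := by
  by_cases hyT : y ∈ T.space
  · obtain ⟨σ, hσ, hyσ⟩ := T.mem_space_iff.1 hyT
    have hspan : affineSpan ℝ (σ : Set E) = A :=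
      hy.affineSpan_eq ((face_subset_vertices hσ).trans hX) (T.indep hσ) (hcard σ hσ)
        (convexHull_subset_affineSpan _ hyσ)
    rw [Set.indicator_of_mem hyT,
      Finset.sum_eq_single_of_mem σ ((mem_spanningFaces hT).2 ⟨hσ, hspan⟩),
      hullIndicator_of_mem hyσ, Pi.one_apply]
    intro τ hτ hne
    obtain ⟨hτT, hτA⟩ := (mem_spanningFaces hT).1 hτ
    refine hullIndicator_of_notMem fun hyτ => hne ?_
    exact (IsGenericIn.face_subset_of_mem hX hτT (hτA ▸ hy) hyτ hσ hyσ).antisymm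
      (IsGenericIn.face_subset_of_mem hX hσ (hspan ▸ hy) hyσ hτT hyτ)
  · rw [Set.indicator_of_notMem hyT]
    exact Finset.sum_eq_zero fun σ hσ => hullIndicator_of_notMem fun hyσ =>
      hyT (T.mem_space_iff.2 ⟨σ, ((mem_spanningFaces hT).1 hσ).1, hyσ⟩)

theorem eventually_sum_lineMap_smul_mem_iff {s : Finset E} {w c : E → ℝ} {u : E}
    (hs : AffineIndependent ℝ ((↑) : s → E)) (hw : ∑ v ∈ s, w v = 1) (hc : ∑ v ∈ s, c v = 1)
    (hpos : ∀ v ∈ s, v ≠ u → 0 < w v) (hu : u ∈ s) (hwu : w u = 0) :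
    ∀ᶠ r in 𝓝 (0 : ℝ), ∑ v ∈ s, lineMap (w v) (c v) r • v ∈ convexHull ℝ (s : Set E) ↔
      0 ≤ r * c u := by
  have hsmall : ∀ᶠ r in 𝓝 (0 : ℝ), ∀ v ∈ s, v ≠ u → 0 < lineMap (w v) (c v) r :=
    (eventually_all_finset s).2 fun v hv => eventually_imp_distrib_left.2 fun hvu =>
      eventually_lineMap_pos (hpos v hv hvu) (c v)
  filter_upwards [hsmall] with r hr
  rw [sum_smul_mem_convexHull_iff hs (sum_lineMap_eq_one hw hc r)]
  have hru : lineMap (w u) (c u) r = r * c u := by simp [hwu, lineMap_apply_ring']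
  refine ⟨fun h => hru ▸ h u hu, fun h v hv => ?_⟩
  rcases eq_or_ne v u with rfl | hvu
  exacts [hru ▸ h, (hr v hv hvu).le]

theorem tendsto_neg_nhdsNE_zero : Tendsto (fun r : ℝ => -r) (𝓝[≠] 0) (𝓝[≠] 0) := by
  have h : map (fun r : ℝ => -r) (𝓝[≠] 0) = 𝓝[≠] (-0) := Filter.neg_nhdsNE
  rw [neg_zero] at h
  exact h.le

theorem eventually_hullIndicator_add_eq_one {w : E → ℝ} {z a : E}
    (hτ : AffineIndependent ℝ ((↑) : τ → E)) (hρτ : ρ ⊆ τ) (hcard : τ.card = ρ.card + 1)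
    (hw : IsConvexRep ρ id z w) (hpos : ∀ v ∈ ρ, 0 < w v)
    (haτ : a ∈ affineSpan ℝ (τ : Set E)) (haρ : a ∉ affineSpan ℝ (ρ : Set E)) :
    ∀ᶠ r in 𝓝[≠] (0 : ℝ), hullIndicator (τ : Set E) (lineMap z a r) +
      hullIndicator (τ : Set E) (lineMap z a (-r)) = 1 := by
  classical
  obtain ⟨u, huρ, rfl⟩ : ∃ u ∉ ρ, insert u ρ = τ := by
    rw [← Finset.covBy_iff_exists_insert, Finset.covBy_iff_card_sdiff_eq_one]
    exact ⟨hρτ, by rw [Finset.card_sdiff_of_subset hρτ]; omega⟩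
  obtain ⟨c, hc, rfl⟩ := mem_affineSpan_coe_iff.1 haτ
  have hcu : c u ≠ 0 := fun h => haρ <| mem_affineSpan_coe_iff.2
    ⟨c, by simpa [huρ, h] using hc, by simp [huρ, h]⟩
  set w' : E → ℝ := Function.update w u 0 with hw'
  have hw'ρ : ∀ v ∈ ρ, w' v = w v := fun v hv =>
    Function.update_of_ne (ne_of_mem_of_not_mem hv huρ) _ _
  have hsum : ∑ v ∈ insert u ρ, w' v = 1 := by
    rw [Finset.sum_insert huρ, Finset.sum_congr rfl hw'ρ, hw.sum_eq_one]; simp [hw']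
  have hsmul : ∑ v ∈ insert u ρ, w' v • v = z := by
    rw [Finset.sum_insert huρ, Finset.sum_congr rfl fun v hv => by rw [hw'ρ v hv],
      ← hw.sum_smul_eq]; simp [hw']
  have hmem := eventually_sum_lineMap_smul_mem_iff hτ hsum hc
    (fun v hv hvu => by
      rw [hw'ρ v (Finset.mem_of_mem_insert_of_ne hv hvu)]
      exact hpos v (Finset.mem_of_mem_insert_of_ne hv hvu))
    (Finset.mem_insert_self u ρ) (by simp [hw'])
  simp only [← lineMap_sum_smul, hsmul] at hmem
  replace hmem := hmem.filter_mono (nhdsWithin_le_nhds (s := {0}ᶜ))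
  filter_upwards [hmem, tendsto_neg_nhdsNE_zero.eventually hmem, self_mem_nhdsWithin]
    with r hr hr_neg hr0
  rw [neg_mul] at hr_neg
  rcases (mul_ne_zero hr0 hcu).lt_or_gt with h | h
  · rw [hullIndicator_of_notMem (mt hr.1 h.not_ge),
      hullIndicator_of_mem (hr_neg.2 (by linarith)), zero_add]
  · rw [hullIndicator_of_mem (hr.2 h.le), hullIndicator_of_notMem (mt hr_neg.1 (by linarith)),
      add_zero]

end Facets

section FacetParity

variable {E : Type*} [NormedAddCommGroup E] [NormedSpace ℝ E] [DecidableEq E]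
  {A : AffineSubspace ℝ E} {T : Geometry.SimplicialComplex ℝ E} (hT : T.faces.Finite)
  {ρ : Finset E} {z : E}

theorem even_card_spanningFaces_superset
    (hcard : ∀ σ ∈ T.faces, σ.card ≤ Module.finrank ℝ A.direction + 1)
    (hρ : ρ ∈ T.faces) (hρA : affineSpan ℝ (ρ : Set E) ≤ A)
    (hρcard : ρ.card = Module.finrank ℝ A.direction) (hzρ : z ∈ convexHull ℝ (ρ : Set E))
    (hz : IsGenericIn T.vertices (affineSpan ℝ (ρ : Set E)) z)
    (hspace : ∀ a ∈ A, ∀ᶠ r in 𝓝 (0 : ℝ), lineMap z a r ∈ T.space) :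
    Even (Finset.card {τ ∈ spanningFaces hT A | ρ ⊆ τ}) := by
  have hzA : z ∈ A := hρA hz.1
  obtain ⟨a, haA, ha⟩ := exists_isGenericIn_affineSpan (vertices_finite hT) A.convex ⟨z, hzA⟩
  rw [AffineSubspace.affineSpan_coe] at ha
  obtain ⟨w, hw, hpos⟩ := hz.exists_isConvexRep_pos (T.indep hρ) (face_subset_vertices hρ) hzρ
  have haρ : a ∉ affineSpan ℝ (ρ : Set E) := fun h =>
    (ha.finrank_direction_lt_card (face_subset_vertices hρ) h).ne' hρcard
  have hsum : ∀ᶠ r in 𝓝[≠] (0 : ℝ),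
      ∑ τ ∈ spanningFaces hT A, hullIndicator (τ : Set E) (lineMap z a r) = 1 := by
    filter_upwards [ha.eventually_lineMap (vertices_finite hT) hzA,
      (hspace a haA).filter_mono nhdsWithin_le_nhds] with r hr hrT
    rw [sum_hullIndicator_spanningFaces hT subset_rfl hr hcard, Set.indicator_of_mem hrT,
      Pi.one_apply]
  -- The line through `z` and `a` crosses the facet `ρ` at `r = 0`, and each simplex containing `ρ`
  -- lies on exactly one side of it.
  have hfaces : ∀ᶠ r in 𝓝[≠] (0 : ℝ), ∀ τ ∈ spanningFaces hT A,
      hullIndicator (τ : Set E) (lineMap z a r) + hullIndicator (τ : Set E) (lineMap z a (-r)) =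
        if ρ ⊆ τ then 1 else 0 := by
    refine (eventually_all_finset _).2 fun τ hτ => ?_
    obtain ⟨hτT, hτA⟩ := (mem_spanningFaces hT).1 hτ
    split_ifs with hρτ
    · exact eventually_hullIndicator_add_eq_one (T.indep hτT) hρτ
        (by rw [card_of_mem_spanningFaces hτ, hρcard]) hw hpos (hτA ▸ haA) haρ
    · have hzτ : z ∉ convexHull ℝ (τ : Set E) := fun h =>
        hρτ (hz.face_subset_of_mem subset_rfl hρ hzρ hτT h)
      have hout : ∀ᶠ r in 𝓝[≠] (0 : ℝ), lineMap z a r ∉ convexHull ℝ (τ : Set E) :=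
        ((tendsto_lineMap_nhds_zero z a).mono_left nhdsWithin_le_nhds).eventually
          ((τ.finite_toSet.isClosed_convexHull (𝕜 := ℝ)).compl_mem_nhds hzτ)
      filter_upwards [hout, tendsto_neg_nhdsNE_zero.eventually hout] with r hr hr_neg
      rw [hullIndicator_of_notMem hr, hullIndicator_of_notMem hr_neg, add_zero]
  obtain ⟨r, hr, hr_neg, hrfaces⟩ :=
    (hsum.and ((tendsto_neg_nhdsNE_zero.eventually hsum).and hfaces)).exists
  rw [← ZMod.natCast_eq_zero_iff_even, Finset.card_filter, Nat.cast_sum]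
  calc ∑ τ ∈ spanningFaces hT A, (((if ρ ⊆ τ then 1 else 0 : ℕ)) : ZMod 2)
      = ∑ τ ∈ spanningFaces hT A, (hullIndicator (τ : Set E) (lineMap z a r) +
          hullIndicator (τ : Set E) (lineMap z a (-r))) :=
        Finset.sum_congr rfl fun τ hτ => by rw [hrfaces τ hτ]; split_ifs <;> simp
    _ = 0 := by rw [Finset.sum_add_distrib, hr, hr_neg]; rfl

end FacetParity

section MovingVertices

variable {E : Type*} [AddCommGroup E] [Module ℝ E] {A : AffineSubspace ℝ E} {X : Set E}
  {y : E}

theorem sum_hullIndicator_image_compl_singleton [FiniteDimensional ℝ A.direction] {ι : Type*}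
    [Fintype ι] {q : ι → E} (hy : IsGenericIn X A y) (hqX : ∀ i, q i ∈ X)
    (hqA : ∀ i, q i ∈ A) (hcard : Fintype.card ι = Module.finrank ℝ A.direction + 2) :
    ∑ j, hullIndicator (q '' {j}ᶜ) y = 0 := by
  classical
  have hgen (i j : ι) (hij : i ≠ j) : y ∉ convexHull ℝ (q '' {i, j}ᶜ) := by
    intro h
    have himage : (({i, j}ᶜ : Finset ι).image q : Set E) = q '' {i, j}ᶜ := by
      rw [Finset.coe_image, Finset.coe_compl, Finset.coe_pair]
    have hlt := hy.finrank_direction_lt_card (G := ({i, j}ᶜ : Finset ι).image q)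
      (by rw [himage]; exact Set.image_subset_iff.2 fun i _ => hqX i)
      (by rw [himage]; exact convexHull_subset_affineSpan _ h)
    have hle := (hlt.trans_le Finset.card_image_le).trans_eq (Finset.card_compl _)
    rw [Finset.card_pair hij] at hle
    omega
  have hdep : ¬AffineIndependent ℝ q := by
    intro h
    have hle : vectorSpan ℝ (Set.range q) ≤ A.direction := by
      rw [← direction_affineSpan]
      exact AffineSubspace.direction_le (affineSpan_le.2 (Set.range_subset_iff.2 hqA))
    have : Nonempty ι := Fintype.card_pos_iff.1 (by omega)
    have := h.finrank_vectorSpan_add_one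
    have := Submodule.finrank_mono hle
    omega
  have heven := even_card_mem_convexHull_image_compl_singleton hgen hdep
  rw [← ZMod.natCast_eq_zero_iff_even, Finset.card_filter, Nat.cast_sum] at heven
  rw [← heven]
  exact Finset.sum_congr rfl fun j _ => by simp [hullIndicator, Set.indicator_apply]

variable [DecidableEq E] {φ φ' f : E → E} {v : E} {σ : Finset E}

theorem hullIndicator_image_eq_add_sum_erase [FiniteDimensional ℝ A.direction]
    (hy : IsGenericIn X A y) (hcard : σ.card = Module.finrank ℝ A.direction + 1) (hv : v ∈ σ)
    (hφφ' : ∀ u ≠ v, φ' u = φ u) (hφX : ∀ u ∈ σ, φ u ∈ X) (hφA : ∀ u ∈ σ, φ u ∈ A)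
    (hvX : φ' v ∈ X) (hvA : φ' v ∈ A) :
    hullIndicator (φ' '' σ) y = hullIndicator (φ '' σ) y +
      ∑ u ∈ σ.erase v, hullIndicator (insert (φ' v) (φ '' (σ.erase u))) y := by
  set q : Option σ → E := fun o => o.elim (φ' v) fun u => φ u
  have himage_none : q '' {none}ᶜ = φ '' σ := by
    rw [← Set.compl_range_some, compl_compl, ← Set.range_comp, Set.image_eq_range]
    rfl
  have himage_some (u : σ) : q '' {some u}ᶜ = insert (φ' v) (φ '' (σ.erase u)) := by
    ext x
    constructor
    · rintro ⟨_ | w, hw, rfl⟩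
      · exact Set.mem_insert _ _
      · exact .inr ⟨w, Finset.mem_erase.2 ⟨fun h => hw (congrArg some (Subtype.ext h)), w.2⟩, rfl⟩
    · rintro (rfl | ⟨w, hw, rfl⟩)
      · exact ⟨none, by simp, rfl⟩
      · exact ⟨some ⟨w, Finset.mem_of_mem_erase hw⟩,
          fun h => Finset.ne_of_mem_erase hw (congrArg Subtype.val (Option.some.inj h)), rfl⟩
  have himage_v : φ' '' σ = insert (φ' v) (φ '' (σ.erase v)) := by
    rw [← Finset.insert_erase hv, Finset.coe_insert, Set.image_insert_eq, Finset.insert_erase hv,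
      Set.image_congr fun u hu => hφφ' u (Finset.ne_of_mem_erase hu)]
  have hsum := sum_hullIndicator_image_compl_singleton (q := q) hy
    (by rintro (_ | u); exacts [hvX, hφX u u.2]) (by rintro (_ | u); exacts [hvA, hφA u u.2])
    (by rw [Fintype.card_option, Fintype.card_coe, hcard])
  simp only [Fintype.sum_option, himage_none, himage_some] at hsum
  rw [Finset.sum_coe_sort σ fun u => hullIndicator (insert (φ' v) (φ '' (σ.erase u))) y,
    ← Finset.add_sum_erase σ _ hv, ← himage_v] at hsum
  rw [← CharTwo.add_eq_zero]
  linear_combination hsum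

variable {T : Geometry.SimplicialComplex ℝ E} (hT : T.faces.Finite)

theorem sum_erase_eq_sum_faces_subset {M : Type*} [AddCommMonoid M] (g : Finset E → M)
    (hσ : σ ∈ T.faces) (hv : v ∈ σ) {m : ℕ} (hcard : σ.card = m + 1) :
    ∑ u ∈ σ.erase v, g (σ.erase u) =
      ∑ ρ ∈ hT.toFinset with (ρ.card = m ∧ v ∈ ρ) ∧ ρ ⊆ σ, g ρ := by
  refine Finset.sum_nbij (fun u => σ.erase u) (fun u hu => ?_)
    ((Finset.erase_injOn σ).mono (Finset.erase_subset v σ)) (fun ρ hρ => ?_) fun _ _ => rfl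
  · obtain ⟨huv, hu⟩ := Finset.mem_erase.1 hu
    have hvu : v ∈ σ.erase u := Finset.mem_erase.2 ⟨huv.symm, hv⟩
    simp only [Finset.mem_filter, Set.Finite.mem_toFinset]
    exact ⟨T.down_closed hσ (Finset.erase_subset u σ) ⟨v, hvu⟩,
      ⟨by rw [Finset.card_erase_of_mem hu, hcard, Nat.add_sub_cancel], hvu⟩,
      Finset.erase_subset u σ⟩
  · simp only [Finset.mem_coe, Finset.mem_filter, Set.Finite.mem_toFinset] at hρ
    obtain ⟨-, ⟨hρm, hvρ⟩, hρσ⟩ := hρ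
    obtain ⟨u, hu, rfl⟩ : ∃ u ∉ ρ, insert u ρ = σ := by
      rw [← Finset.covBy_iff_exists_insert, Finset.covBy_iff_card_sdiff_eq_one]
      exact ⟨hρσ, by rw [Finset.card_sdiff_of_subset hρσ]; omega⟩
    exact ⟨u, by simpa using fun h : u = v => hu (h ▸ hvρ), Finset.erase_insert hu⟩

theorem sum_hullIndicator_image_eq_of_forall_ne [FiniteDimensional ℝ A.direction]
    (hy : IsGenericIn X A y) (hX : T.vertices ⊆ X) (hφφ' : ∀ u ≠ v, φ' u = φ u)
    (hφ : ∀ σ ∈ spanningFaces hT A, ∀ u ∈ σ, φ u ∈ X ∧ φ u ∈ A)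
    (hφ' : ∀ σ ∈ spanningFaces hT A, ∀ u ∈ σ, φ' u ∈ X ∧ φ' u ∈ A)
    (hfacet : ∀ ρ ∈ T.faces, ρ.card = Module.finrank ℝ A.direction →
      Even (Finset.card {τ ∈ spanningFaces hT A | ρ ⊆ τ}) ∨
        Set.MapsTo φ ρ (affineSpan ℝ (ρ : Set E)) ∧ Set.MapsTo φ' ρ (affineSpan ℝ (ρ : Set E))) :
    ∑ σ ∈ spanningFaces hT A, hullIndicator (φ' '' σ) y =
      ∑ σ ∈ spanningFaces hT A, hullIndicator (φ '' σ) y := by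
  set m := Module.finrank ℝ A.direction
  set g : Finset E → ZMod 2 := fun ρ => hullIndicator (insert (φ' v) (φ '' ρ)) y
  have hsimplex : ∀ σ ∈ spanningFaces hT A, hullIndicator (φ' '' σ) y = hullIndicator (φ '' σ) y +
      ∑ ρ ∈ hT.toFinset with (ρ.card = m ∧ v ∈ ρ) ∧ ρ ⊆ σ, g ρ := by
    intro σ hσ
    by_cases hv : v ∈ σ
    · rw [hullIndicator_image_eq_add_sum_erase hy (card_of_mem_spanningFaces hσ) hv hφφ'
        (fun u hu => (hφ σ hσ u hu).1) (fun u hu => (hφ σ hσ u hu).2) (hφ' σ hσ v hv).1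
        (hφ' σ hσ v hv).2, ← sum_erase_eq_sum_faces_subset hT g ((mem_spanningFaces hT).1 hσ).1 hv
        (card_of_mem_spanningFaces hσ)]
    · rw [Finset.sum_eq_zero, add_zero,
        Set.image_congr fun u hu => hφφ' u (ne_of_mem_of_not_mem hu hv)]
      exact fun ρ hρ => absurd ((Finset.mem_filter.1 hρ).2.2 (Finset.mem_filter.1 hρ).2.1.2) hv
  rw [Finset.sum_congr rfl hsimplex, Finset.sum_add_distrib, add_eq_left]
  rw [Finset.sum_comm' (t' := {ρ ∈ hT.toFinset | ρ.card = m ∧ v ∈ ρ})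
    (s' := fun ρ => {τ ∈ spanningFaces hT A | ρ ⊆ τ}) (by simp; tauto)]
  refine Finset.sum_eq_zero fun ρ hρ => ?_
  obtain ⟨hρT, hρm, hvρ⟩ : ρ ∈ T.faces ∧ ρ.card = m ∧ v ∈ ρ := by simpa using hρ
  rw [Finset.sum_const]
  rcases hfacet ρ hρT hρm with heven | ⟨hmaps, hmaps'⟩
  · rw [nsmul_eq_mul, ZMod.natCast_eq_zero_iff_even.2 heven, zero_mul]
  · suffices g ρ = 0 by rw [this, smul_zero]
    refine hullIndicator_of_notMem fun h => ?_
    have hsub : insert (φ' v) (φ '' ρ) ⊆ (affineSpan ℝ (ρ : Set E) : Set E) :=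
      Set.insert_subset (hmaps' hvρ) hmaps.image_subset
    exact (hy.finrank_direction_lt_card ((face_subset_vertices hρT).trans hX)
      (convexHull_min hsub (AffineSubspace.convex _) h)).ne' hρm

theorem sum_hullIndicator_image_spanningFaces [FiniteDimensional ℝ A.direction]
    (hy : IsGenericIn X A y) (hX : T.vertices ⊆ X) (hfX : Set.MapsTo f T.vertices X)
    (hfA : ∀ σ ∈ spanningFaces hT A, Set.MapsTo f σ A)
    (hfacet : ∀ ρ ∈ T.faces, ρ.card = Module.finrank ℝ A.direction →
      Even (Finset.card {τ ∈ spanningFaces hT A | ρ ⊆ τ}) ∨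
        Set.MapsTo f ρ (affineSpan ℝ (ρ : Set E))) :
    ∑ σ ∈ spanningFaces hT A, hullIndicator (f '' σ) y =
      ∑ σ ∈ spanningFaces hT A, hullIndicator (σ : Set E) y := by
  have hmove (W : Finset E) : ∀ σ ∈ spanningFaces hT A, ∀ u ∈ σ,
      W.piecewise f id u ∈ X ∧ W.piecewise f id u ∈ A := by
    intro σ hσ u hu
    obtain ⟨hσT, hσA⟩ := (mem_spanningFaces hT).1 hσ
    have huT := face_subset_vertices hσT hu
    by_cases huW : u ∈ W
    · rw [W.piecewise_eq_of_mem _ _ huW]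
      exact ⟨hfX huT, hfA σ hσ hu⟩
    · rw [W.piecewise_eq_of_notMem _ _ huW]
      exact ⟨hX huT, hσA ▸ subset_affineSpan ℝ _ hu⟩
  have hmaps (W : Finset E) {ρ : Finset E} (h : Set.MapsTo f ρ (affineSpan ℝ (ρ : Set E))) :
      Set.MapsTo (W.piecewise f id) ρ (affineSpan ℝ (ρ : Set E)) := fun u hu =>
    W.piecewise_cases f id (· ∈ affineSpan ℝ (ρ : Set E)) (h hu) (subset_affineSpan ℝ _ hu)
  have hpiecewise (W : Finset E) :
      ∑ σ ∈ spanningFaces hT A, hullIndicator (W.piecewise f id '' σ) y =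
        ∑ σ ∈ spanningFaces hT A, hullIndicator (σ : Set E) y := by
    induction W using Finset.induction_on with
    | empty => simp
    | insert v W _ ih =>
      rw [← ih]
      refine sum_hullIndicator_image_eq_of_forall_ne hT hy hX (v := v) (fun u hu => ?_) (hmove _)
        (hmove _) fun ρ hρ hcard => (hfacet ρ hρ hcard).imp_right fun h => ⟨hmaps _ h, hmaps _ h⟩
      rw [Finset.piecewise_insert, Function.update_of_ne hu]
  rw [← hpiecewise (vertices_finite hT).toFinset]
  refine Finset.sum_congr rfl fun σ hσ =>
    congrArg (hullIndicator · y) (Set.image_congr fun u hu => ?_)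
  have huT := face_subset_vertices ((mem_spanningFaces hT).1 hσ).1 hu
  rw [Finset.piecewise_eq_of_mem _ _ _ ((vertices_finite hT).mem_toFinset.2 huT)]

end MovingVertices

section NearBoundary

variable {E : Type*} [NormedAddCommGroup E] [NormedSpace ℝ E] {A : AffineSubspace ℝ E}
  {X s : Set E} {x : E}

theorem exists_forall_isGenericIn_hullIndicator_eq (hs : s.Finite) (hsX : s ⊆ X)
    (hx : A ≤ affineSpan ℝ s → x ∉ intrinsicFrontier ℝ (convexHull ℝ s)) :
    ∃ c, ∀ᶠ y in 𝓝[A] x, IsGenericIn X A y → hullIndicator s y = c := by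
  by_cases hA : A ≤ affineSpan ℝ s
  · by_cases hxs : x ∈ convexHull ℝ s
    · have hnhds := not_not.1 ((mem_intrinsicFrontier_iff_of_mem hxs).not.1 (hx hA))
      rw [affineSpan_convexHull] at hnhds
      refine ⟨1, ?_⟩
      filter_upwards [nhdsWithin_mono x hA hnhds] with y hy _
      exact hullIndicator_of_mem hy
    · have hopen := (hs.isClosed_convexHull (𝕜 := ℝ)).isOpen_compl.mem_nhds hxs
      refine ⟨0, ?_⟩
      filter_upwards [nhdsWithin_le_nhds hopen] with y hy _
      exact hullIndicator_of_notMem hy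
  · refine ⟨0, .of_forall fun y hy => hullIndicator_of_notMem fun hys => hA ?_⟩
    exact hy.2 s hsX (convexHull_subset_affineSpan s hys)

end NearBoundary

namespace Polytope

variable {n d : ℕ} {P : Polytope n d} {C D : Finset (EuclideanSpace ℝ (Fin n))}
  {A : AffineSubspace ℝ (EuclideanSpace ℝ (Fin n))} {x z : EuclideanSpace ℝ (Fin n)}

theorem finite_vertices (P : Polytope n d) : P.vertices.Finite :=
  (P.finite_cells.biUnion fun C _ => C.finite_toSet).subset fun _ ⟨_, hC, hv⟩ =>
    Set.mem_biUnion hC hv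

theorem coe_subset_vertices (hC : C ∈ P.cells) :
    (C : Set (EuclideanSpace ℝ (Fin n))) ⊆ P.vertices :=
  fun _ hv => ⟨C, hC, hv⟩

theorem mem_space_iff : x ∈ P.space ↔ ∃ C ∈ P.cells, x ∈ convexHull ℝ (C : Set _) := by
  simp [space]

theorem eventually_mem_of_mem_cell (P : Polytope n d) (x : EuclideanSpace ℝ (Fin n)) :
    ∀ᶠ y in 𝓝 x, ∀ D ∈ P.cells, y ∈ convexHull ℝ (D : Set _) → x ∈ convexHull ℝ (D : Set _) := by
  refine (eventually_all_finite P.finite_cells).2 fun D _ => ?_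
  by_cases hxD : x ∈ convexHull ℝ (D : Set (EuclideanSpace ℝ (Fin n)))
  · exact .of_forall fun _ _ => hxD
  · have hclosed := D.finite_toSet.isClosed_convexHull (𝕜 := ℝ)
    filter_upwards [hclosed.isOpen_compl.mem_nhds hxD] with y hy hyD
    exact absurd hyD hy

theorem affineSpan_eq_of_le (hA : (A : Set (EuclideanSpace ℝ (Fin n))).Nonempty)
    (hAd : Module.finrank ℝ A.direction = d) (hD : D ∈ P.cells)
    (hle : A ≤ affineSpan ℝ (D : Set _)) : affineSpan ℝ (D : Set _) = A := by
  refine (eq_of_le_of_finrank_direction_le hA hle ?_).symm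
  rw [direction_affineSpan, hAd]
  exact P.dim_le D hD

theorem exists_cell_forall_eventually_lineMap_mem (hD : D ∈ P.cells)
    (hz : z ∈ convexHull ℝ (D : Set _)) :
    ∃ F ∈ P.cells, F ⊆ D ∧ z ∈ convexHull ℝ (F : Set _) ∧
      ∀ a ∈ affineSpan ℝ (F : Set _), ∀ᶠ r in 𝓝 (0 : ℝ), lineMap z a r ∈ P.space := by
  have hF := P.face_mem D hD _ (minimalFace_nonempty hz) (isHullFace_minimalFace hz)
  obtain ⟨w, hw, hpos⟩ := exists_isConvexRep_minimalFace_pos hz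
  refine ⟨_, hF, minimalFace_subset, mem_convexHull_coe_iff.2 ⟨w, hw⟩, fun a ha => ?_⟩
  exact (hw.eventually_lineMap_mem hpos ha).mono fun r hr => mem_space_iff.2 ⟨_, hF, hr⟩

theorem exists_isGenericIn_forall_mem_cell (P : Polytope n d)
    {X K : Set (EuclideanSpace ℝ (Fin n))} (hX : X.Finite) (hK : Convex ℝ K) (hx : x ∈ K) :
    ∃ y ∈ K, IsGenericIn X (affineSpan ℝ K) y ∧
      ∀ D ∈ P.cells, y ∈ convexHull ℝ (D : Set _) → x ∈ convexHull ℝ (D : Set _) := by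
  obtain ⟨y, hy, hyK, hnear⟩ := ((frequently_isGenericIn_affineSpan hX hK hx).and_eventually
    (eventually_mem_nhdsWithin.and
      ((P.eventually_mem_of_mem_cell x).filter_mono nhdsWithin_le_nhds))).exists
  exact ⟨y, hyK, hy, hnear⟩

theorem eventually_lineMap_mem_space_of_isGenericIn {X : Set (EuclideanSpace ℝ (Fin n))}
    {B : AffineSubspace ℝ (EuclideanSpace ℝ (Fin n))} (hX : P.vertices ⊆ X)
    (hz : IsGenericIn X B z) (hD : D ∈ P.cells) (hzD : z ∈ convexHull ℝ (D : Set _))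
    (hrank : Module.finrank ℝ (vectorSpan ℝ (D : Set (EuclideanSpace ℝ (Fin n)))) =
      Module.finrank ℝ B.direction + 1)
    (hcell : ∀ F ∈ P.cells, z ∈ convexHull ℝ (F : Set _) →
      ¬affineSpan ℝ (F : Set (EuclideanSpace ℝ (Fin n))) ≤ B)
    {a : EuclideanSpace ℝ (Fin n)} (ha : a ∈ affineSpan ℝ (D : Set _)) :
    ∀ᶠ r in 𝓝 (0 : ℝ), lineMap z a r ∈ P.space := by
  obtain ⟨F, hF, hFD, hzF, hFmem⟩ := exists_cell_forall_eventually_lineMap_mem hD hzD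
  have hBF := hz.2 _ ((coe_subset_vertices hF).trans hX) (convexHull_subset_affineSpan _ hzF)
  have hlt := finrank_direction_lt_of_lt ⟨z, hz.1⟩ (lt_of_le_not_ge hBF (hcell F hF hzF))
  have hFD : affineSpan ℝ (F : Set (EuclideanSpace ℝ (Fin n))) = affineSpan ℝ (D : Set _) :=
    eq_of_le_of_finrank_direction_le ⟨z, hBF hz.1⟩ (affineSpan_mono ℝ (Finset.coe_subset.2 hFD))
      (by rwa [direction_affineSpan ℝ (D : Set (EuclideanSpace ℝ (Fin n))), hrank])
  exact hFmem a (hFD ▸ ha)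

theorem mem_intrinsicFrontier_of_mem (hC : C ∈ P.cells) (hD : D ∈ P.cells)
    (hspan : affineSpan ℝ (D : Set (EuclideanSpace ℝ (Fin n))) = affineSpan ℝ (C : Set _))
    (hxC : x ∈ intrinsicFrontier ℝ (convexHull ℝ (C : Set _)))
    (hxD : x ∈ convexHull ℝ (D : Set _)) :
    x ∈ intrinsicFrontier ℝ (convexHull ℝ (D : Set _)) := by
  have hxC' := intrinsicFrontier_subset (C.finite_toSet.isClosed_convexHull (𝕜 := ℝ)) hxC
  rw [mem_intrinsicFrontier_iff_of_mem hxC', affineSpan_convexHull, ← hspan] at hxC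
  rw [mem_intrinsicFrontier_iff_of_mem hxD, affineSpan_convexHull]
  refine fun hnhds => hxC (mem_of_superset hnhds ?_)
  have hxDC : x ∈ convexHull ℝ ((D : Set (EuclideanSpace ℝ (Fin n))) ∩ C) :=
    P.inter_eq D hD C hC ▸ ⟨hxD, hxC'⟩
  refine (subset_of_isExtreme_of_mem_nhdsWithin (P.inter_face D hD C hC).isExtreme hxDC ?_).trans
    (convexHull_mono Set.inter_subset_right)
  rwa [affineSpan_convexHull]

theorem eventually_notMem_space_of_isGenericIn {X : Set (EuclideanSpace ℝ (Fin n))}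
    (hX : P.vertices ⊆ X) (hC : C ∈ P.cells)
    (hCd : Module.finrank ℝ (vectorSpan ℝ (C : Set (EuclideanSpace ℝ (Fin n)))) = d)
    (hxC : x ∈ intrinsicFrontier ℝ (convexHull ℝ (C : Set _)))
    (huniq : ∀ D ∈ P.cells,
      Module.finrank ℝ (vectorSpan ℝ (D : Set (EuclideanSpace ℝ (Fin n)))) = d →
        x ∈ intrinsicFrontier ℝ (convexHull ℝ (D : Set _)) → D = C) :
    ∀ᶠ y in 𝓝 x, IsGenericIn X (affineSpan ℝ (C : Set _)) y → y ∉ convexHull ℝ (C : Set _) →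
      y ∉ P.space := by
  filter_upwards [P.eventually_mem_of_mem_cell x] with y hnear hy hyC hyP
  obtain ⟨D, hD, hyD⟩ := mem_space_iff.1 hyP
  have hspan := affineSpan_eq_of_le ⟨y, hy.1⟩ (by rw [direction_affineSpan, hCd]) hD
    (hy.2 _ ((coe_subset_vertices hD).trans hX) (convexHull_subset_affineSpan _ hyD))
  have hDC : D = C := huniq D hD (by rw [← direction_affineSpan, hspan, direction_affineSpan, hCd])
    (mem_intrinsicFrontier_of_mem hC hD hspan hxC (hnear D hD hyD))
  exact hyC (hDC ▸ hyD)

end Polytope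

section Triangulation

variable {n d : ℕ} {P : Polytope n d} {T : Geometry.SimplicialComplex ℝ (EuclideanSpace ℝ (Fin n))}
  {A : AffineSubspace ℝ (EuclideanSpace ℝ (Fin n))} {σ ρ : Finset (EuclideanSpace ℝ (Fin n))}
  {p : EuclideanSpace ℝ (Fin n)} {f : EuclideanSpace ℝ (Fin n) → EuclideanSpace ℝ (Fin n)}

theorem IsTriangulation.exists_cell (hT : IsTriangulation P T) (hσ : σ ∈ T.faces)
    (hp : p ∈ convexHull ℝ (σ : Set _)) :
    ∃ D ∈ P.cells, p ∈ convexHull ℝ (D : Set _) ∧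
      affineSpan ℝ (σ : Set (EuclideanSpace ℝ (Fin n))) ≤ affineSpan ℝ (D : Set _) := by
  obtain ⟨y, hyσ, hy, hnear⟩ :=
    P.exists_isGenericIn_forall_mem_cell P.finite_vertices (convex_convexHull ℝ _) hp
  obtain ⟨D, hD, hyD⟩ := Polytope.mem_space_iff.1
    (hT.space_eq ▸ Geometry.SimplicialComplex.mem_space_iff.2 ⟨σ, hσ, hyσ⟩)
  rw [affineSpan_convexHull] at hy
  exact ⟨D, hD, hnear D hD hyD,
    hy.2 _ (Polytope.coe_subset_vertices hD) (convexHull_subset_affineSpan _ hyD)⟩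

theorem IsTriangulation.exists_cell_affineSpan_eq (hT : IsTriangulation P T) (hσ : σ ∈ T.faces)
    (hd : Module.finrank ℝ (affineSpan ℝ (σ : Set (EuclideanSpace ℝ (Fin n)))).direction = d)
    (hp : p ∈ convexHull ℝ (σ : Set _)) :
    ∃ D ∈ P.cells, p ∈ convexHull ℝ (D : Set _) ∧
      affineSpan ℝ (D : Set (EuclideanSpace ℝ (Fin n))) = affineSpan ℝ (σ : Set _) := by
  obtain ⟨D, hD, hpD, hle⟩ := hT.exists_cell hσ hp
  exact ⟨D, hD, hpD,
    Polytope.affineSpan_eq_of_le ⟨p, convexHull_subset_affineSpan _ hp⟩ hd hD hle⟩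

theorem IsTriangulation.card_le (hT : IsTriangulation P T) (hσ : σ ∈ T.faces) :
    σ.card ≤ d + 1 := by
  obtain ⟨v, hv⟩ := T.nonempty_of_mem_faces hσ
  obtain ⟨D, hD, -, hle⟩ := hT.exists_cell hσ (subset_convexHull ℝ _ hv)
  rw [← finrank_direction_affineSpan_add_one (T.indep hσ) ⟨v, hv⟩]
  refine Nat.succ_le_succ ((Submodule.finrank_mono (AffineSubspace.direction_le hle)).trans ?_)
  rw [direction_affineSpan]
  exact P.dim_le D hD

open Classical in
theorem IsTriangulation.even_card_or_forall_exists_cell (hT : IsTriangulation P T)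
    (hAd : Module.finrank ℝ A.direction = d) (hρ : ρ ∈ T.faces) (hρd : ρ.card = d) :
    Even (Finset.card {τ ∈ spanningFaces hT.finite A | ρ ⊆ τ}) ∨
      ∀ v ∈ ρ, ∃ F ∈ P.cells, v ∈ convexHull ℝ (F : Set _) ∧
        affineSpan ℝ (F : Set (EuclideanSpace ℝ (Fin n))) ≤ affineSpan ℝ (ρ : Set _) := by
  by_cases hρσ : ∃ σ ∈ spanningFaces hT.finite A, ρ ⊆ σ
  swap
  · exact .inl (by simp [Finset.filter_eq_empty_iff.2 fun σ hσ h => hρσ ⟨σ, hσ, h⟩])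
  obtain ⟨σ, hσ, hρσ⟩ := hρσ
  obtain ⟨hσT, rfl⟩ := (mem_spanningFaces hT.finite).1 hσ
  refine or_iff_not_imp_right.2 fun hcell => ?_
  push Not at hcell
  obtain ⟨v, hv, hcell⟩ := hcell
  obtain ⟨z, hzρ, hz, hnear⟩ := P.exists_isGenericIn_forall_mem_cell
    ((vertices_finite hT.finite).union P.finite_vertices) (convex_convexHull ℝ (ρ : Set _))
    (subset_convexHull ℝ _ hv)
  rw [affineSpan_convexHull] at hz
  obtain ⟨D, hD, hzD, hDσ⟩ := hT.exists_cell_affineSpan_eq hσT hAd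
    (convexHull_mono (Finset.coe_subset.2 hρσ) hzρ)
  have hDd : Module.finrank ℝ (vectorSpan ℝ (D : Set (EuclideanSpace ℝ (Fin n)))) =
      Module.finrank ℝ (affineSpan ℝ (ρ : Set (EuclideanSpace ℝ (Fin n)))).direction + 1 := by
    rw [finrank_direction_affineSpan_add_one (T.indep hρ) ⟨v, hv⟩, hρd, ← direction_affineSpan,
      hDσ, hAd]
  refine even_card_spanningFaces_superset hT.finite (fun τ hτ => hAd ▸ hT.card_le hτ) hρ
    (affineSpan_mono ℝ (Finset.coe_subset.2 hρσ)) (hρd.trans hAd.symm) hzρ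
    (hz.mono Set.subset_union_left) fun a ha => ?_
  rw [hT.space_eq]
  exact Polytope.eventually_lineMap_mem_space_of_isGenericIn Set.subset_union_right hz hD hzD hDd
    (fun F hF hzF => hcell F hF (hnear F hF hzF)) (hDσ ▸ ha)

/-- The vertex map `f` sends every vertex of `T` that lies in a cell of `P` into the affine span of
that cell. The final position of the
vertices under the homotopy is such a map. -/
def PreservesCellSpans (P : Polytope n d)
    (T : Geometry.SimplicialComplex ℝ (EuclideanSpace ℝ (Fin n)))
    (f : EuclideanSpace ℝ (Fin n) → EuclideanSpace ℝ (Fin n)) : Prop :=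
  ∀ v ∈ T.vertices, ∀ C ∈ P.cells, v ∈ convexHull ℝ (C : Set _) → f v ∈ affineSpan ℝ (C : Set _)

theorem PreservesCellSpans.sum_hullIndicator_image (hf : PreservesCellSpans P T f)
    (hT : IsTriangulation P T) (hAd : Module.finrank ℝ A.direction = d)
    {X : Set (EuclideanSpace ℝ (Fin n))} (hX : T.vertices ⊆ X) (hfX : f '' T.vertices ⊆ X)
    {y : EuclideanSpace ℝ (Fin n)} (hy : IsGenericIn X A y) :
    ∑ σ ∈ spanningFaces hT.finite A, hullIndicator (f '' σ) y = T.space.indicator 1 y := by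
  classical
  rw [← sum_hullIndicator_spanningFaces hT.finite hX hy fun τ hτ => hAd ▸ hT.card_le hτ]
  refine sum_hullIndicator_image_spanningFaces hT.finite hy hX (Set.mapsTo_iff_image_subset.2 hfX)
    (fun σ hσ v hv => ?_) fun ρ hρ hρd => ?_
  · obtain ⟨hσT, rfl⟩ := (mem_spanningFaces hT.finite).1 hσ
    obtain ⟨D, hD, hvD, hspan⟩ := hT.exists_cell_affineSpan_eq hσT hAd (subset_convexHull ℝ _ hv)
    exact hspan ▸ hf v (face_subset_vertices hσT hv) D hD hvD
  · refine (hT.even_card_or_forall_exists_cell hAd hρ (hρd.trans hAd)).imp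
      (fun h => by convert h) fun h v hv => ?_
    obtain ⟨F, hF, hvF, hle⟩ := h v hv
    exact hle (hf v (face_subset_vertices hρ hv) F hF hvF)

theorem PreservesCellSpans.exists_forall_isGenericIn_indicator_eq (hf : PreservesCellSpans P T f)
    (hT : IsTriangulation P T) (hAd : Module.finrank ℝ A.direction = d)
    {X : Set (EuclideanSpace ℝ (Fin n))} (hX : T.vertices ⊆ X) (hfX : f '' T.vertices ⊆ X)
    {x : EuclideanSpace ℝ (Fin n)}
    (hx : ∀ σ ∈ T.faces, σ.card = d + 1 → Set.InjOn f σ →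
      x ∉ intrinsicFrontier ℝ (convexHull ℝ (f '' σ))) :
    ∃ c : ZMod 2, ∀ᶠ y in 𝓝[A] x, IsGenericIn X A y → T.space.indicator 1 y = c := by
  have hlocal : ∀ σ ∈ spanningFaces hT.finite A, ∃ c, ∀ᶠ y in 𝓝[A] x, IsGenericIn X A y →
      hullIndicator (f '' σ) y = c := fun σ hσ => by
    have hσT := ((mem_spanningFaces hT.finite).1 hσ).1
    have hσd := card_of_mem_spanningFaces hσ
    exact exists_forall_isGenericIn_hullIndicator_eq (σ.finite_toSet.image f)
      ((Set.image_mono (face_subset_vertices hσT)).trans hfX) fun hle =>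
      hx σ hσT (hAd ▸ hσd) <| injOn_of_le_affineSpan_image (T.nonempty_of_mem_faces hσT)
        hσd.le hle
  choose! c hc using hlocal
  refine ⟨∑ σ ∈ spanningFaces hT.finite A, c σ, ?_⟩
  filter_upwards [(eventually_all_finset _).2 hc] with y hcy hy
  rw [← hf.sum_hullIndicator_image hT hAd hX hfX hy]
  exact Finset.sum_congr rfl fun σ hσ => hcy σ hσ hy

theorem PreservesCellSpans.exists_mem_intrinsicFrontier_image (hf : PreservesCellSpans P T f)
    (hT : IsTriangulation P T) {x : EuclideanSpace ℝ (Fin n)} (hx : x ∈ P.boundary) :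
    ∃ σ ∈ T.faces, σ.card = d + 1 ∧ Set.InjOn f σ ∧
      x ∈ intrinsicFrontier ℝ (convexHull ℝ (f '' σ)) := by
  obtain ⟨C, ⟨hC, hCd, hxC⟩, huniq⟩ := hx
  have hclosed := C.finite_toSet.isClosed_convexHull (𝕜 := ℝ)
  set A := affineSpan ℝ (C : Set (EuclideanSpace ℝ (Fin n))) with hA
  have hAd : Module.finrank ℝ A.direction = d := by rw [hA, direction_affineSpan, hCd]
  set X := P.vertices ∪ (T.vertices ∪ f '' T.vertices)
  have hX : X.Finite := P.finite_vertices.union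
    ((vertices_finite hT.finite).union ((vertices_finite hT.finite).image f))
  by_contra! hfrontier
  obtain ⟨c, hc⟩ := hf.exists_forall_isGenericIn_indicator_eq hT hAd
    (Set.subset_union_left.trans Set.subset_union_right)
    (Set.subset_union_right.trans Set.subset_union_right) hfrontier
  have hone : c = 1 := by
    have hgen := frequently_isGenericIn_affineSpan hX (convex_convexHull ℝ (C : Set _))
      (intrinsicFrontier_subset hclosed hxC)
    rw [affineSpan_convexHull] at hgen
    obtain ⟨y, hy, hyC, hyc⟩ := (hgen.and_eventually (eventually_mem_nhdsWithin.and
      (hc.filter_mono (nhdsWithin_mono x (convexHull_subset_affineSpan _))))).exists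
    rw [← hyc hy, hT.space_eq, Set.indicator_of_mem (Polytope.mem_space_iff.2 ⟨C, hC, hyC⟩)]
    rfl
  have hzero : c = 0 := by
    have hgen := frequently_isGenericIn_affineSpan_and_notMem hX hclosed hxC
    rw [affineSpan_convexHull] at hgen
    have hout := Polytope.eventually_notMem_space_of_isGenericIn (X := X) Set.subset_union_left
      hC hCd hxC fun D hD hDd hxD => huniq D ⟨hD, hDd, hxD⟩
    obtain ⟨y, ⟨hy, hyC⟩, hyP, hyc⟩ := (hgen.and_eventually
      ((hout.filter_mono nhdsWithin_le_nhds).and hc)).exists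
    rw [← hyc hy, hT.space_eq, Set.indicator_of_notMem (hyP hy hyC)]
  exact one_ne_zero (hone.symm.trans hzero)

end Triangulation

section LabelHomotopy

variable {n : ℕ} {T : Geometry.SimplicialComplex ℝ (EuclideanSpace ℝ (Fin n))} {κ : Type*}
  {s : Finset (EuclideanSpace ℝ (Fin n))} {x : EuclideanSpace ℝ (Fin n)}

theorem isConvexRep_iff_of_support_subset {w : EuclideanSpace ℝ (Fin n) →₀ ℝ}
    (hw : w.support ⊆ s) :
    IsConvexRep s id x w ↔ (∀ v, 0 ≤ w v) ∧ (w.sum fun _ a => a) = 1 ∧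
      (w.sum fun v a => a • v) = x := by
  simp only [Finsupp.sum_of_support_subset _ hw, implies_true, zero_smul]
  refine ⟨fun h => ⟨fun v => ?_, h.2, h.3⟩, fun h => ⟨fun v _ => h.1 v, h.2.1, h.2.2⟩⟩
  by_cases hv : v ∈ s
  · exact h.nonneg v hv
  · exact (Finsupp.notMem_support_iff.1 fun h => hv (hw h)).ge

theorem exists_isBarycentric (hs : s ∈ T.faces) {w : EuclideanSpace ℝ (Fin n) → ℝ}
    (hw : IsConvexRep s id x w) : ∃ w, IsBarycentric T x w := by
  classical
  set ω : EuclideanSpace ℝ (Fin n) →₀ ℝ :=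
    Finsupp.onFinset s (fun v => if v ∈ s then w v else 0) (by simp +contextual)
  have hωs : ω.support ⊆ s := Finsupp.support_onFinset_subset
  have hωv : ∀ v ∈ s, ω v = w v := fun v hv => by simp [ω, hv]
  have hωx : IsConvexRep s id x ω :=
    ⟨fun v hv => (hωv v hv).symm ▸ hw.nonneg v hv, (Finset.sum_congr rfl hωv).trans hw.sum_eq_one,
      (Finset.sum_congr rfl fun v hv => by rw [hωv v hv]).trans hw.sum_smul_eq⟩
  obtain ⟨hnonneg, hsum, hsmul⟩ := (isConvexRep_iff_of_support_subset hωs).1 hωx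
  refine ⟨ω, T.down_closed hs hωs (Finsupp.support_nonempty_iff.2 ?_), hnonneg, hsum, hsmul⟩
  intro h
  simp [h] at hsum

theorem IsBarycentric.support_subset {w : EuclideanSpace ℝ (Fin n) →₀ ℝ}
    (hw : IsBarycentric T x w) (hs : s ∈ T.faces) (hx : x ∈ convexHull ℝ (s : Set _)) :
    w.support ⊆ s := by
  have hwx := (isConvexRep_iff_of_support_subset subset_rfl).2 ⟨hw.2, hw.3, hw.4⟩
  have hxs := T.inter_subset_convexHull hw.support_mem hs
    ⟨mem_convexHull_coe_iff.2 ⟨w, hwx⟩, hx⟩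
  rw [← Set.image_id (_ ∩ _), mem_convexHull_image_iff (I := w.support) Set.inter_subset_left]
    at hxs
  obtain ⟨u, hu, hus⟩ := hxs
  intro v hv
  by_contra hvs
  have hwu := weights_eq_of_affineIndependent (T.indep hw.support_mem)
    (hwx.sum_eq_one.trans hu.sum_eq_one.symm) (hwx.sum_smul_eq.trans hu.sum_smul_eq.symm) v hv
  exact Finsupp.mem_support_iff.1 hv (hwu.trans (hus v hv fun h => hvs h.2))

theorem labelHomotopy_eq_sum (label : EuclideanSpace ℝ (Fin n) → κ)
    (dest : κ → EuclideanSpace ℝ (Fin n)) (t : ℝ) (hs : s ∈ T.faces)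
    {w : EuclideanSpace ℝ (Fin n) → ℝ} (hw : IsConvexRep s id x w) :
    labelHomotopy T label dest t x = ∑ v ∈ s, w v • ((1 - t) • v + t • dest (label v)) := by
  have hb : IsBarycentric T x (barycentric T x) := by
    have hex := exists_isBarycentric hs hw
    rw [barycentric, dif_pos hex]
    exact hex.choose_spec
  have hsub := hb.support_subset hs (mem_convexHull_coe_iff.2 ⟨w, hw⟩)
  have hbx := (isConvexRep_iff_of_support_subset hsub).2 ⟨hb.2, hb.3, hb.4⟩
  rw [labelHomotopy, Finsupp.sum_of_support_subset _ hsub _ (by simp)]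
  refine Finset.sum_congr rfl fun v hv => ?_
  rw [weights_eq_of_affineIndependent (T.indep hs) (hbx.sum_eq_one.trans hw.sum_eq_one.symm)
    (hbx.sum_smul_eq.trans hw.sum_smul_eq.symm) v hv]

theorem labelHomotopy_image_convexHull (label : EuclideanSpace ℝ (Fin n) → κ)
    (dest : κ → EuclideanSpace ℝ (Fin n)) (t : ℝ) (hs : s ∈ T.faces) :
    labelHomotopy T label dest t '' convexHull ℝ (s : Set (EuclideanSpace ℝ (Fin n))) =
      convexHull ℝ ((fun v => (1 - t) • v + t • dest (label v)) '' s) := by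
  ext y
  rw [mem_convexHull_image_iff subset_rfl]
  constructor
  · rintro ⟨x, hx, rfl⟩
    obtain ⟨w, hw⟩ := mem_convexHull_coe_iff.1 hx
    exact ⟨w, ⟨hw.nonneg, hw.sum_eq_one, (labelHomotopy_eq_sum label dest t hs hw).symm⟩,
      fun v hv hvs => absurd hv hvs⟩
  · rintro ⟨w, hw, -⟩
    have hwx : IsConvexRep s id (∑ v ∈ s, w v • v) w := ⟨hw.nonneg, hw.sum_eq_one, rfl⟩
    exact ⟨_, mem_convexHull_coe_iff.2 ⟨w, hwx⟩,
      (labelHomotopy_eq_sum label dest t hs hwx).trans hw.sum_smul_eq⟩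

theorem labelHomotopy_one_image_convexHull (label : EuclideanSpace ℝ (Fin n) → κ)
    (dest : κ → EuclideanSpace ℝ (Fin n)) (hs : s ∈ T.faces) :
    labelHomotopy T label dest 1 '' convexHull ℝ (s : Set (EuclideanSpace ℝ (Fin n))) =
      convexHull ℝ (dest '' (label '' s)) := by
  simp [labelHomotopy_image_convexHull label dest 1 hs, Set.image_image]

end LabelHomotopy

theorem mainTheorem5_general {n d : ℕ} {κ : Type*} {P : Polytope n d}
    {T : Geometry.SimplicialComplex ℝ (EuclideanSpace ℝ (Fin n))} (hT : IsTriangulation P T)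
    {label : EuclideanSpace ℝ (Fin n) → κ} {dest : κ → EuclideanSpace ℝ (Fin n)}
    (hdest : PreservesCellSpans P T fun v => dest (label v))
    {S : Set (Finset (EuclideanSpace ℝ (Fin n)))} (hS : S ⊆ T.faces)
    (hcover : ¬ P.boundary ⊆ ⋃ s ∈ S, intrinsicFrontier ℝ
      (labelHomotopy T label dest 1 '' convexHull ℝ (s : Set (EuclideanSpace ℝ (Fin n))))) :
    ∃ τ, IsFullColoured d T label τ ∧
      ∀ s ∈ S, label '' (τ : Set (EuclideanSpace ℝ (Fin n))) ≠
        label '' (s : Set (EuclideanSpace ℝ (Fin n))) := by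
  obtain ⟨x, hx, hxS⟩ := Set.not_subset.1 hcover
  obtain ⟨τ, hτ, hcard, hinj, hxτ⟩ := hdest.exists_mem_intrinsicFrontier_image hT hx
  refine ⟨τ, ⟨hτ, hcard, fun u hu v hv huv => hinj hu hv (congrArg dest huv)⟩, fun s hs heq => ?_⟩
  refine hxS (Set.mem_biUnion hs ?_)
  rwa [labelHomotopy_one_image_convexHull label dest (hS hs), ← heq, Set.image_image]

theorem mainTheorem5 {n d : ℕ} {κ : Type*} (P : Polytope n d)
    (T : Geometry.SimplicialComplex ℝ (EuclideanSpace ℝ (Fin n))) (hT : IsTriangulation P T)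
    (label : EuclideanSpace ℝ (Fin n) → κ) (hlabel : IsGeneralizedSperner P T label)
    (hboundary : Set.InjOn label (P.vertices ∩ P.boundary))
    (dest : κ → EuclideanSpace ℝ (Fin n)) (hdest : IsDestination P T label dest)
    (S : Set (Finset (EuclideanSpace ℝ (Fin n)))) (hS : S ⊆ T.faces)
    (hcover : ¬ P.boundary ⊆ ⋃ s ∈ S, intrinsicFrontier ℝ
      (labelHomotopy T label dest 1 '' convexHull ℝ (s : Set (EuclideanSpace ℝ (Fin n))))) :
    ∃ τ, IsFullColoured d T label τ ∧
      ∀ s ∈ S, label '' (τ : Set (EuclideanSpace ℝ (Fin n))) ≠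
        label '' (s : Set (EuclideanSpace ℝ (Fin n))) :=
  mainTheorem5_general hT (fun v hv => (hdest v hv).2.2) hS hcover
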